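/- Let $c:\mathbb{R}\to\mathbb{R}$ be a cost function with the following properties: $c\ge 0$ and $c(0)=0$; $c(-x)=c(x)$; $c(x)\le c(x')$ whenever $|x|\le|x'|$; $c$ is continuous; and there are $\alpha,\beta>0$ with $c(x)\sim\beta x^{\alpha}$ as $x\to\infty$. Let $C>0$. Let $D(\cdot\|\cdot)\in[0,\infty]$ denote the Kullback–Leibler divergence, let $(T_aP)(B):=P(B-a)$ be the shift of a Borel measure $P$ on $\mathbb{R}$ by $a$, and put $$\mathrm{KL}^\star:=\inf_{P_{Y|X}}\ \sup_{x,x'\in\mathbb{R}:\,|x-x'|\le 1} D(P_{Y|X=x}\,\|\,P_{Y|X=x'}),$$ where the infimum is over all Markov kernels $P_{Y|X}$ on $\mathbb{R}$ with $\sup_{x\in\mathbb{R}}\mathbb{E}[c(Y-x)\mid X=x]\le C$. For positive integers $n,N$ and $r\in(0,1)$, partition $\mathbb{R}$ into the intervals $\mathcal{J}_{n,0}:=[-\tfrac1{2n},\tfrac1{2n}]$, $\mathcal{J}_{n,i}:=(\tfrac{i-1/2}{n},\tfrac{i+1/2}{n}]$ for integers $i>0$ and $\mathcal{J}_{n,i}:=[\tfrac{i-1/2}{n},\tfrac{i+1/2}{n})$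 for integers $i<0$. For $\boldsymbol p=(p_0,\dots,p_N)\in[0,1]^{N+1}$ let $P_{n,r,\boldsymbol p}$ be the Borel measure on $\mathbb{R}$ whose Lebesgue density equals $n\,p_{|i|}$ on $\mathcal{J}_{n,i}$ if $|i|<N$ and $n\,p_N\,r^{|i|-N}$ on $\mathcal{J}_{n,i}$ if $|i|\ge N$; it is a probability measure if and only if $S_{r,\boldsymbol p}:=p_0+\sum_{i=1}^{N-1}2p_i+\frac{2p_N}{1-r}=1$. For a cost level $C'>0$ let $$\mathrm{KL}^\star_{n,N,r}(C'):=\inf\Bigl\{\sup_{|a|\le1}D(P\|T_aP)\ :\ P=P_{n,r,\boldsymbol p},\ \boldsymbol p\in[0,1]^{N+1},\ S_{r,\boldsymbol p}=1,\ \mathbb{E}_P[c]\le C'\Bigr\}$$ (with $\inf\emptyset=\infty$). Then the limit $$\mathrm{KL}^\star_{\mathrm{Cactus}}:=\lim_{\varepsilon\to0^+}\ \inf_{n,N\ge1,\ r\in(0,1)}\mathrm{KL}^\star_{n,N,r}(C+\varepsilon)$$ exists, and $\mathrm{KL}^\star_{\mathrm{Cactus}}=\mathrm{KL}^\star$. 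-/

import Mathlib

open MeasureTheory ProbabilityTheory InformationTheory Filter Topology Asymptotics
open scoped ENNReal

/-- Admissible cost functions `c : ℝ → ℝ`. -/
structure IsCostFunction (c : ℝ → ℝ) : Prop where
  nonneg : ∀ x, 0 ≤ c x
  map_zero : c 0 = 0
  symm : ∀ x, c (-x) = c x
  mono : ∀ x x', |x| ≤ |x'| → c x ≤ c x'
  continuous : Continuous c
  tail : ∃ α β : ℝ, 0 < α ∧ 0 < β ∧ c ~[atTop] fun x => β * x ^ α

/-- The expectation `𝔼_P[c] ∈ [0, ∞]` of a nonnegative cost `c`. -/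
noncomputable def expectedCost (c : ℝ → ℝ) (P : Measure ℝ) : ℝ≥0∞ :=
  ∫⁻ y, ENNReal.ofReal (c y) ∂P

/-- The shift `T_a P` of a measure, `(T_a P)(B) = P(B - a)`. -/
noncomputable def shiftMeasure (a : ℝ) (P : Measure ℝ) : Measure ℝ :=
  P.map fun y => y + a

/-- `KL*`, with sensitivity `s` and cost level `C`: the infimum over all Markov kernels `κ` on `ℝ`
with `sup_x 𝔼[c(Y - x) | X = x] ≤ C` of `sup_{|x - x'| ≤ s} D(κ x ‖ κ x')`. -/
noncomputable def optimalKL (c : ℝ → ℝ) (s C : ℝ) : ℝ≥0∞ :=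
  ⨅ (κ : Kernel ℝ ℝ) (_ : IsMarkovKernel κ)
    (_ : ⨆ x : ℝ, expectedCost (fun y => c (y - x)) (κ x) ≤ ENNReal.ofReal C),
    ⨆ (x : ℝ) (x' : ℝ) (_ : |x - x'| ≤ s), klDiv (κ x) (κ x')

/-- The intervals `J_{n,i}`, `i ∈ ℤ`, partitioning `ℝ` (for `n > 0`). -/
def cactusCell (n : ℕ) (i : ℤ) : Set ℝ :=
  if i = 0 then Set.Icc (-1 / (2 * n)) (1 / (2 * n))
  else if 0 < i then Set.Ioc ((i - 1 / 2) / n) ((i + 1 / 2) / n)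
  else Set.Ico ((i - 1 / 2) / n) ((i + 1 / 2) / n)

/-- The value of the piecewise constant function `f_{n,r,p}` on the cells `J_{n,i}` with
`|i| = k`. -/
noncomputable def cactusValue (n N : ℕ) (r : ℝ) (p : Fin (N + 1) → ℝ) (k : ℕ) : ℝ :=
  if h : k < N then n * p ⟨k, by omega⟩ else n * p (Fin.last N) * r ^ (k - N)

/-- The piecewise constant function `f_{n,r,p}`. The absolute value of the index of the cell
containing `x` is `max 0 ⌈n |x| - 1/2⌉`, see `cactusDensity_of_mem_cell`. -/
noncomputable def cactusDensity (n N : ℕ) (r : ℝ) (p : Fin (N + 1) → ℝ) (x : ℝ) : ℝ :=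
  cactusValue n N r p ⌈n * |x| - 1 / 2⌉₊

/-- On `J_{n,i}` the function `f_{n,r,p}` is equal to `n p_{|i|}` if `|i| < N` and to
`n p_N r^{|i| - N}` if `|i| ≥ N`. -/
theorem cactusDensity_of_mem_cell {n : ℕ} (hn : 0 < n) (N : ℕ) (r : ℝ) (p : Fin (N + 1) → ℝ)
    {i : ℤ} {x : ℝ} (hx : x ∈ cactusCell n i) :
    cactusDensity n N r p x = cactusValue n N r p i.natAbs := by
  have hn' : (0 : ℝ) < n := by exact_mod_cast hn
  unfold cactusDensity
  congr 1
  unfold cactusCell at hx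
  split_ifs at hx with h0 h1
  · subst h0
    obtain ⟨h2, h3⟩ := hx
    have h4 : |x| ≤ 1 / (2 * n) := abs_le.2 ⟨by rw [← neg_div]; exact h2, h3⟩
    rw [le_div_iff₀ (by positivity)] at h4
    simp only [Int.natAbs_zero, Nat.ceil_eq_zero]
    linarith
  · obtain ⟨k, rfl⟩ := Int.eq_ofNat_of_zero_le h1.le
    have hk : 1 ≤ k := by omega
    have hk' : (1 : ℝ) ≤ k := by exact_mod_cast hk
    obtain ⟨h2, h3⟩ := hx
    rw [div_lt_iff₀ hn'] at h2
    rw [le_div_iff₀ hn'] at h3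
    push_cast at h2 h3
    have hx0 : 0 < x := pos_of_mul_pos_left (by linarith) hn'.le
    rw [Int.natAbs_natCast, Nat.ceil_eq_iff (by omega), abs_of_pos hx0, Nat.cast_sub hk]
    push_cast
    constructor <;> linarith
  · obtain ⟨k, rfl⟩ : ∃ k : ℕ, i = -(k : ℤ) := ⟨i.natAbs, by omega⟩
    have hk : 1 ≤ k := by omega
    have hk' : (1 : ℝ) ≤ k := by exact_mod_cast hk
    obtain ⟨h2, h3⟩ := hx
    rw [div_le_iff₀ hn'] at h2
    rw [lt_div_iff₀ hn'] at h3
    push_cast at h2 h3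
    have hx0 : x < 0 := by
      by_contra h
      have := mul_nonneg (not_lt.1 h) hn'.le
      linarith
    rw [Int.natAbs_neg, Int.natAbs_natCast, Nat.ceil_eq_iff (by omega), abs_of_neg hx0,
      Nat.cast_sub hk]
    push_cast
    constructor <;> linarith

/-- The measure `P_{n,r,p}` with Lebesgue density `f_{n,r,p}`. -/
noncomputable def cactusMeasure (n N : ℕ) (r : ℝ) (p : Fin (N + 1) → ℝ) : Measure ℝ :=
  volume.withDensity fun x => ENNReal.ofReal (cactusDensity n N r p x)

/-- The total mass `S_{r,p} = p_0 + ∑_{i=1}^{N-1} 2 p_i + 2 p_N / (1 - r)` (for `N > 0`). -/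
noncomputable def cactusMass (N : ℕ) (r : ℝ) (p : Fin (N + 1) → ℝ) : ℝ :=
  p 0 + ∑ i ∈ Finset.Ioo 0 (Fin.last N), 2 * p i + 2 * p (Fin.last N) / (1 - r)

/-- The class `𝒞_{n,N,r}` of all `P_{n,r,p}` with `p ∈ [0,1]^{N+1}` and `S_{r,p} = 1`. -/
def cactusClass (n N : ℕ) (r : ℝ) : Set (Measure ℝ) :=
  {P | ∃ p : Fin (N + 1) → ℝ,
    (∀ i, p i ∈ Set.Icc (0 : ℝ) 1) ∧ cactusMass N r p = 1 ∧ P = cactusMeasure n N r p}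

/-- `KL*_{n,N,r}(C)`: the infimum of `sup_{|a| ≤ 1} D(P ‖ T_a P)` over all `P ∈ 𝒞_{n,N,r}` with
`𝔼_P[c] ≤ C` (equal to `∞` if there is no such `P`). -/
noncomputable def cactusKL (c : ℝ → ℝ) (n N : ℕ) (r C : ℝ) : ℝ≥0∞ :=
  ⨅ (P : Measure ℝ) (_ : P ∈ cactusClass n N r) (_ : expectedCost c P ≤ ENNReal.ofReal C),
    ⨆ (a : ℝ) (_ : |a| ≤ 1), klDiv P (shiftMeasure a P)

/-- The infimum of `KL*_{n,N,r}(C)` over positive integers `n`, `N` and `r ∈ (0,1)`. -/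
noncomputable def cactusInfKL (c : ℝ → ℝ) (C : ℝ) : ℝ≥0∞ :=
  ⨅ (n : ℕ) (_ : 0 < n) (N : ℕ) (_ : 0 < N) (r : ℝ) (_ : r ∈ Set.Ioo (0 : ℝ) 1),
    cactusKL c n N r C

/-! Every admissible kernel can be approximated by Cactus noise at a slightly larger cost, and
convexity removes the extra cost.

For `cactusInfKL c (C + ε) ≤ optimalKL c 1 C`, let `κ` be admissible with worst divergence `W`. Draw
`X` from a law so flat that shifts by at most `1` change its density by a factor at most `e^l`. The
law `P` of `Y - X` has cost at most `C`, and `D(P ‖ T_a P) ≤ W + l` by the chain rule and data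
processing (`ShiftQuasiInvariant.shiftBound_noiseLaw`). `P` is then made into a Cactus measure
(`exists_cactus_of_shiftBound`): mix in a little of a law with polynomial tails, keep only the
masses of cells of width `1/n`, symmetrise them, and replace them from index `N` on by a geometric
sequence of the same total mass. Quantising and symmetrising preserve the divergence bound, and
continuity of `c` controls the cost. For fixed `n`, the polynomial lower bound on the masses makes
the log ratios affected by the new tail `O(log N)`. The cost grows like a power, so it dominates
`log N`, and finiteness of the expected cost makes the error vanish.

Conversely, mixing a Cactus measure of cost slightly above `C` with a narrow law of cost at most
`C/4` brings the cost below `C` and raises the divergence bound only slightly; adding the resulting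
noise to the input is a kernel.

Noise laws are handled through `ShiftBound`, which is affine in `P` and hence stable under mixing
and averaging. The way back to `klDiv` is taken only for lattice measures, where the divergence
reduces to explicit sums; this is why the mixture in the converse is approximated by a Cactus
measure once more. -/

/-! ### Dual divergence bounds, mixtures and quasi-invariance. -/

/-- Dual form of the bound `D(P ‖ T_a P) ≤ V` for all `|a| ≤ 1`. -/
def ShiftBound (P : Measure ℝ) (V : ℝ) : Prop :=
  ∀ a : ℝ, |a| ≤ 1 → ∀ f : ℝ → ℝ, Measurable f → (∃ B, ∀ x, |f x| ≤ B) →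
    ∫ x, f x ∂P ≤ V + ∫ x, Real.exp (f (x + a)) ∂P - 1

/-- Quasi-invariance under shifts by at most `1`. -/
def ShiftQuasiInvariant (μ : Measure ℝ) (l : ℝ) : Prop :=
  ∀ a : ℝ, |a| ≤ 1 → μ ≤ ENNReal.ofReal (Real.exp l) • μ.map (fun x => x + a)

theorem integrable_of_abs_le {α : Type*} [MeasurableSpace α] {μ : Measure α} [IsFiniteMeasure μ]
    {f : α → ℝ} (hf : Measurable f) {B : ℝ} (hB : ∀ x, |f x| ≤ B) : Integrable f μ :=
  Integrable.of_bound hf.aestronglyMeasurable B (ae_of_all _ hB)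

theorem integrable_exp_of_abs_le {α : Type*} [MeasurableSpace α] {μ : Measure α}
    [IsFiniteMeasure μ] {f : α → ℝ} (hf : Measurable f) {B : ℝ} (hB : ∀ x, |f x| ≤ B) :
    Integrable (fun x => Real.exp (f x)) μ :=
  integrable_of_abs_le (B := Real.exp B) hf.exp fun x => by
    rw [abs_of_pos (Real.exp_pos _)]
    exact Real.exp_le_exp.2 ((le_abs_self _).trans (hB x))

/-- Young's inequality: `exp t - 1` is the convex conjugate of `klFun`, with equality at `t = log
x`. -/
theorem mul_le_klFun_add_exp {x : ℝ} (hx : 0 ≤ x) (t : ℝ) :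
    x * t ≤ klFun x + Real.exp t - 1 := by
  rw [klFun_apply]
  rcases hx.eq_or_lt with rfl | hx
  · simp [(Real.exp_pos t).le]
  · have h1 := Real.add_one_le_exp (t - Real.log x)
    rw [Real.exp_sub, Real.exp_log hx] at h1
    have h2 := mul_le_mul_of_nonneg_left h1 hx.le
    rw [mul_div_cancel₀ _ hx.ne'] at h2
    linarith

/-- One half of the Donsker–Varadhan formula. -/
theorem integral_le_klDiv_add_integral_exp {α : Type*} [MeasurableSpace α] (μ ν : Measure α)
    [IsProbabilityMeasure μ] [IsProbabilityMeasure ν] (h : klDiv μ ν ≠ ∞) {f : α → ℝ}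
    (hf : Measurable f) (hB : ∃ B, ∀ x, |f x| ≤ B) :
    ∫ x, f x ∂μ ≤ (klDiv μ ν).toReal + ∫ x, Real.exp (f x) ∂ν - 1 := by
  obtain ⟨B, hB⟩ := hB
  obtain ⟨hac, hint⟩ := klDiv_ne_top_iff.1 h
  have h1 : Integrable (fun x => klFun (μ.rnDeriv ν x).toReal) ν :=
    (integrable_klFun_rnDeriv_iff hac).2 hint
  have h2 := integrable_exp_of_abs_le (μ := ν) hf hB
  have h3 : Integrable (fun x => (μ.rnDeriv ν x).toReal * f x) ν := by
    refine (Measure.integrable_toReal_rnDeriv (μ := μ) (ν := ν)).mul_bdd (c := B)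
      hf.aestronglyMeasurable (ae_of_all _ hB)
  rw [toReal_klDiv_eq_integral_klFun hac, ← integral_rnDeriv_smul hac]
  simp only [smul_eq_mul]
  have h4 : ∫ x, (klFun (μ.rnDeriv ν x).toReal + Real.exp (f x) - 1) ∂ν
      = ∫ x, klFun (μ.rnDeriv ν x).toReal ∂ν + ∫ x, Real.exp (f x) ∂ν - 1 := by
    have h5 : Integrable (fun x => klFun (μ.rnDeriv ν x).toReal + Real.exp (f x)) ν := h1.add h2
    rw [integral_sub h5 (integrable_const _), integral_add h1 h2]
    simp
  rw [← h4]
  exact integral_mono h3 ((h1.add h2).sub (integrable_const _)) fun x =>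
    mul_le_klFun_add_exp ENNReal.toReal_nonneg _

theorem ShiftBound.of_klDiv_le {P : Measure ℝ} [IsProbabilityMeasure P] {V : ℝ} (hV : 0 ≤ V)
    (h : ∀ a : ℝ, |a| ≤ 1 → klDiv P (shiftMeasure a P) ≤ ENNReal.ofReal V) : ShiftBound P V := by
  intro a ha f hf hB
  have : IsProbabilityMeasure (shiftMeasure a P) :=
    Measure.isProbabilityMeasure_map (by fun_prop)
  have h1 := h a ha
  have h2 := integral_le_klDiv_add_integral_exp P (shiftMeasure a P)
    (h1.trans_lt ENNReal.ofReal_lt_top).ne hf hB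
  have h3 := ENNReal.toReal_mono ENNReal.ofReal_ne_top h1
  rw [ENNReal.toReal_ofReal hV] at h3
  rw [shiftMeasure, integral_map (by fun_prop) (by fun_prop)] at h2
  rw [shiftMeasure] at h3
  linarith

theorem ShiftBound.mono {P : Measure ℝ} {V W : ℝ} (h : ShiftBound P V) (hVW : V ≤ W) :
    ShiftBound P W := fun a ha f hf hB => by
  have := h a ha f hf hB
  linarith

/-- The mixture `(1 - t) P + t Q`. -/
noncomputable def mixMeasure (t : ℝ) (P Q : Measure ℝ) : Measure ℝ :=
  ENNReal.ofReal (1 - t) • P + ENNReal.ofReal t • Q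

theorem mixMeasure_isProbabilityMeasure {t : ℝ} (h0 : 0 ≤ t) (h1 : t ≤ 1) (P Q : Measure ℝ)
    [IsProbabilityMeasure P] [IsProbabilityMeasure Q] : IsProbabilityMeasure (mixMeasure t P Q) := by
  constructor
  simp only [mixMeasure, Measure.coe_add, Measure.coe_smul, Pi.add_apply, Pi.smul_apply,
    measure_univ, smul_eq_mul, mul_one]
  rw [← ENNReal.ofReal_add (by linarith) h0]
  simp

theorem integral_mixMeasure {t : ℝ} (h0 : 0 ≤ t) (h1 : t ≤ 1) {P Q : Measure ℝ} {f : ℝ → ℝ}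
    (hP : Integrable f P) (hQ : Integrable f Q) :
    ∫ x, f x ∂(mixMeasure t P Q) = (1 - t) * ∫ x, f x ∂P + t * ∫ x, f x ∂Q := by
  rw [mixMeasure, integral_add_measure (hP.smul_measure ENNReal.ofReal_ne_top)
    (hQ.smul_measure ENNReal.ofReal_ne_top), integral_smul_measure, integral_smul_measure,
    ENNReal.toReal_ofReal h0, ENNReal.toReal_ofReal (by linarith)]
  simp

theorem ShiftBound.mix {t : ℝ} (h0 : 0 ≤ t) (h1 : t ≤ 1) {P Q : Measure ℝ}
    [IsProbabilityMeasure P] [IsProbabilityMeasure Q] {V W : ℝ} (hP : ShiftBound P V)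
    (hQ : ShiftBound Q W) : ShiftBound (mixMeasure t P Q) ((1 - t) * V + t * W) := by
  intro a ha f hf hB
  obtain ⟨B, hB⟩ := hB
  have hf' : Measurable fun x => f (x + a) := by fun_prop
  have hB' : ∀ x, |f (x + a)| ≤ B := fun x => hB _
  rw [integral_mixMeasure h0 h1 (integrable_of_abs_le hf hB) (integrable_of_abs_le hf hB),
    integral_mixMeasure h0 h1 (integrable_exp_of_abs_le hf' hB')
      (integrable_exp_of_abs_le hf' hB')]
  have h3 := mul_le_mul_of_nonneg_left (hP a ha f hf ⟨B, hB⟩) (by linarith : 0 ≤ 1 - t)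
  have h4 := mul_le_mul_of_nonneg_left (hQ a ha f hf ⟨B, hB⟩) h0
  linarith

theorem expectedCost_mixMeasure (c : ℝ → ℝ) (t : ℝ) (P Q : Measure ℝ) :
    expectedCost c (mixMeasure t P Q)
      = ENNReal.ofReal (1 - t) * expectedCost c P + ENNReal.ofReal t * expectedCost c Q := by
  simp [expectedCost, mixMeasure, lintegral_add_measure, lintegral_smul_measure]

theorem expectedCost_mixMeasure_le {c : ℝ → ℝ} {t : ℝ} (h0 : 0 ≤ t) (h1 : t ≤ 1)
    {P Q : Measure ℝ} {A B : ℝ} (hA : 0 ≤ A) (hB : 0 ≤ B)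
    (hP : expectedCost c P ≤ ENNReal.ofReal A) (hQ : expectedCost c Q ≤ ENNReal.ofReal B) :
    expectedCost c (mixMeasure t P Q) ≤ ENNReal.ofReal ((1 - t) * A + t * B) := by
  rw [expectedCost_mixMeasure, ENNReal.ofReal_add (mul_nonneg (by linarith) hA) (mul_nonneg h0 hB),
    ENNReal.ofReal_mul (by linarith), ENNReal.ofReal_mul h0]
  gcongr

theorem ShiftQuasiInvariant.integral_le {μ : Measure ℝ} [IsFiniteMeasure μ] {l : ℝ}
    (h : ShiftQuasiInvariant μ l) {a : ℝ} (ha : |a| ≤ 1) {f : ℝ → ℝ} (hf : Measurable f)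
    (h0 : ∀ x, 0 ≤ f x) (hB : ∃ B, ∀ x, |f x| ≤ B) :
    ∫ x, f x ∂μ ≤ Real.exp l * ∫ x, f (x + a) ∂μ := by
  obtain ⟨B, hB⟩ := hB
  have h1 : Integrable f (ENNReal.ofReal (Real.exp l) • μ.map (fun x => x + a)) :=
    (integrable_of_abs_le hf hB).smul_measure ENNReal.ofReal_ne_top
  have h2 := integral_mono_measure (h a ha) (ae_of_all _ h0) h1
  rwa [integral_smul_measure, ENNReal.toReal_ofReal (Real.exp_pos _).le,
    integral_map (by fun_prop) (by fun_prop), smul_eq_mul] at h2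

/-- The likelihood ratio of `μ` to its shift is at most `e^l`, so its logarithm is at most `l`. In
dual form this is `s + 1 ≤ exp s` at `s = f - l`. -/
theorem ShiftQuasiInvariant.shiftBound {μ : Measure ℝ} [IsProbabilityMeasure μ] {l : ℝ}
    (h : ShiftQuasiInvariant μ l) : ShiftBound μ l := by
  intro a ha f hf hB
  obtain ⟨B, hB⟩ := hB
  have h1 := h.integral_le ha (f := fun x => Real.exp (f x)) hf.exp (fun x => (Real.exp_pos _).le)
    ⟨Real.exp B, fun x => by
      rw [abs_of_pos (Real.exp_pos _)]
      exact Real.exp_le_exp.2 ((le_abs_self _).trans (hB x))⟩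
  have hi := integrable_of_abs_le (μ := μ) hf hB
  have hf' : Measurable fun x => f x - l := by fun_prop
  have hB' : ∀ x, |f x - l| ≤ B + |l| := fun x => (abs_sub _ _).trans (by linarith [hB x])
  have h2 : ∫ x, (f x - l + 1) ∂μ ≤ ∫ x, Real.exp (f x - l) ∂μ :=
    integral_mono ((hi.sub (integrable_const _)).add (integrable_const _))
      (integrable_exp_of_abs_le hf' hB') fun x => Real.add_one_le_exp _
  have hi' : Integrable (fun x => f x - l) μ := hi.sub (integrable_const _)
  rw [integral_add hi' (integrable_const _), integral_sub hi (integrable_const _)] at h2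
  simp only [Real.exp_sub, integral_div, integral_const, probReal_univ, one_smul] at h2
  rw [le_div_iff₀ (Real.exp_pos _)] at h2
  have h3 := h2.trans h1
  rw [mul_comm] at h3
  have := le_of_mul_le_mul_left h3 (Real.exp_pos l)
  linarith

/-! ### Averaging a kernel into a noise law. -/

/-- The law of `Y - X` if `X` has law `μ` and `Y` is drawn from `κ X`. -/
noncomputable def noiseLaw (μ : Measure ℝ) (κ : Kernel ℝ ℝ) : Measure ℝ :=
  (μ ⊗ₘ κ).map fun p => p.2 - p.1

instance (μ : Measure ℝ) (κ : Kernel ℝ ℝ) [IsProbabilityMeasure μ] [IsMarkovKernel κ] :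
    IsProbabilityMeasure (noiseLaw μ κ) :=
  Measure.isProbabilityMeasure_map (by fun_prop)

theorem expectedCost_noiseLaw_le {c : ℝ → ℝ} (hc : Measurable c) (μ : Measure ℝ) (κ : Kernel ℝ ℝ)
    [IsProbabilityMeasure μ] [IsMarkovKernel κ] {A : ℝ≥0∞}
    (h : ∀ x, expectedCost (fun y => c (y - x)) (κ x) ≤ A) :
    expectedCost c (noiseLaw μ κ) ≤ A := by
  rw [expectedCost, noiseLaw, lintegral_map (by fun_prop) (by fun_prop),
    Measure.lintegral_compProd (by fun_prop)]
  calc _ ≤ ∫⁻ x, A ∂μ := lintegral_mono fun x => h x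
    _ = A := by simp

theorem integral_noiseLaw (μ : Measure ℝ) (κ : Kernel ℝ ℝ)
    [IsProbabilityMeasure μ] [IsMarkovKernel κ] {f : ℝ → ℝ} (hf : Measurable f)
    (hB : ∃ B, ∀ x, |f x| ≤ B) :
    ∫ z, f z ∂(noiseLaw μ κ) = ∫ x, ∫ y, f (y - x) ∂(κ x) ∂μ := by
  obtain ⟨B, hB⟩ := hB
  rw [noiseLaw, integral_map (by fun_prop) (by fun_prop), Measure.integral_compProd]
  exact integrable_of_abs_le (by fun_prop) (fun x => hB _)

/-- Chain rule and data processing in dual form: `V` pays for replacing `κ x` by `κ (x + a)`, and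
`l` for shifting the law of the input. -/
theorem ShiftQuasiInvariant.shiftBound_noiseLaw {μ : Measure ℝ} [IsProbabilityMeasure μ] {l : ℝ}
    (h : ShiftQuasiInvariant μ l) (κ : Kernel ℝ ℝ) [IsMarkovKernel κ] {V : ℝ} (hV : 0 ≤ V)
    (hκ : ∀ x x' : ℝ, |x - x'| ≤ 1 → klDiv (κ x) (κ x') ≤ ENNReal.ofReal V) :
    ShiftBound (noiseLaw μ κ) (V + l) := by
  intro a ha f hf hB
  obtain ⟨B, hB⟩ := hB
  have hexpB : ∀ t : ℝ, |t| ≤ B → |Real.exp t| ≤ Real.exp B := fun t ht => by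
    rw [abs_of_pos (Real.exp_pos _)]
    exact Real.exp_le_exp.2 ((le_abs_self _).trans ht)
  have hbd : ∀ (x : ℝ) (g : ℝ → ℝ) (D : ℝ), (∀ y, |g y| ≤ D) → |∫ y, g y ∂(κ x)| ≤ D := by
    intro x g D hg
    simpa using norm_integral_le_of_norm_le_const (μ := κ x) (f := g) (ae_of_all _ hg)
  set G : ℝ → ℝ := fun x => ∫ y, f (y - x) ∂(κ x) with hG
  set H : ℝ → ℝ := fun x => ∫ y, Real.exp (f (y - x)) ∂(κ (x + a)) with hH
  have hGm : Measurable G := by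
    have : StronglyMeasurable fun x => ∫ y, f (y - x) ∂(κ x) :=
      StronglyMeasurable.integral_kernel_prod_right (κ := κ) (f := fun x y => f (y - x))
        (Measurable.stronglyMeasurable (by fun_prop))
    exact this.measurable
  have hHm : Measurable H := by
    have : StronglyMeasurable fun x => ∫ y, Real.exp (f (y - x))
        ∂((κ.comap (fun x : ℝ => x + a) (by fun_prop)) x) :=
      StronglyMeasurable.integral_kernel_prod_right
        (κ := κ.comap (fun x : ℝ => x + a) (by fun_prop)) (f := fun x y => Real.exp (f (y - x)))
        (Measurable.stronglyMeasurable (by fun_prop))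
    exact this.measurable
  have hGB : ∀ x, |G x| ≤ B := fun x => hbd _ _ _ fun y => hB _
  have hHB : ∀ x, |H x| ≤ Real.exp B := fun x => hbd _ _ _ fun y => hexpB _ (hB _)
  rw [integral_noiseLaw μ κ hf ⟨B, hB⟩,
    integral_noiseLaw μ κ (f := fun x => Real.exp (f (x + a))) (by fun_prop)
      ⟨Real.exp B, fun x => hexpB _ (hB _)⟩]
  -- The test function is `y ↦ f (y - x) - l`; the `-l` produces the factor `e^{-l}` that cancels
  -- the `e^l` lost when `x` is shifted below.
  have h1 : ∀ x, G x - l ≤ V + H x / Real.exp l - 1 := by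
    intro x
    have hk : klDiv (κ x) (κ (x + a)) ≤ ENNReal.ofReal V := hκ _ _ (by simpa using ha)
    have h2 := integral_le_klDiv_add_integral_exp (κ x) (κ (x + a))
      (hk.trans_lt ENNReal.ofReal_lt_top).ne (f := fun y => f (y - x) - l) (by fun_prop)
      ⟨B + |l|, fun y => (abs_sub _ _).trans (by linarith [hB (y - x)])⟩
    have h3 := ENNReal.toReal_mono ENNReal.ofReal_ne_top hk
    rw [ENNReal.toReal_ofReal hV] at h3
    rw [integral_sub (integrable_of_abs_le (by fun_prop) (fun y => hB (y - x)))
      (integrable_const _)] at h2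
    simp only [Real.exp_sub, integral_div, integral_const, probReal_univ, one_smul] at h2
    linarith
  have h4 : ∫ x, G x - l ∂μ ≤ ∫ x, (V + H x / Real.exp l - 1) ∂μ := by
    have hi := integrable_of_abs_le (μ := μ) hGm hGB
    have hi' := (integrable_of_abs_le (μ := μ) hHm hHB).div_const (Real.exp l)
    exact integral_mono (hi.sub (integrable_const _))
      (((integrable_const _).add hi').sub (integrable_const _)) h1
  have h5 : ∫ x, (V + H x / Real.exp l - 1) ∂μ = V + (∫ x, H x ∂μ) / Real.exp l - 1 := by
    have hi' := (integrable_of_abs_le (μ := μ) hHm hHB).div_const (Real.exp l)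
    have hi'' : Integrable (fun x => V + H x / Real.exp l) μ := (integrable_const _).add hi'
    rw [integral_sub hi'' (integrable_const _), integral_add (integrable_const _) hi', integral_div]
    simp
  rw [h5, integral_sub (integrable_of_abs_le hGm hGB) (integrable_const _)] at h4
  have h6 := h.integral_le (a := -a) (by simpa using ha) hHm
    (fun x => integral_nonneg fun y => (Real.exp_pos _).le) ⟨_, hHB⟩
  have h7 : ∀ x, H (x + -a) = ∫ y, Real.exp (f (y - x + a)) ∂(κ x) := by
    intro x
    simp only [hH, neg_add_cancel_right]
    congr 1 with y
    congr 2
    ring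
  simp only [h7] at h6
  rw [mul_comm, ← div_le_iff₀ (Real.exp_pos _)] at h6
  simp only [integral_const, probReal_univ, one_smul] at h4
  linarith

/-! ### Growth of the cost function. -/

namespace IsCostFunction

variable {c : ℝ → ℝ}

theorem map_abs (hc : IsCostFunction c) (x : ℝ) : c |x| = c x :=
  le_antisymm (hc.mono _ _ (by simp)) (hc.mono _ _ (by simp))

theorem exists_rpow_bounds (hc : IsCostFunction c) : ∃ α K : ℝ, 0 < α ∧ 0 < K ∧
    (∀ x, c x ≤ K * (1 + |x|) ^ α) ∧ ∀ x, (1 + |x|) ^ α ≤ K * (1 + c x) := by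
  obtain ⟨α, β, hα, hβ, h⟩ := hc.tail
  have h1 := h.isLittleO.bound (show (0 : ℝ) < 1 / 2 by norm_num)
  obtain ⟨x₀, hx₀⟩ := eventually_atTop.1 (h1.and (eventually_ge_atTop 1))
  have hx1 : (1 : ℝ) ≤ x₀ := (hx₀ x₀ le_rfl).2
  have hb : ∀ x, x₀ ≤ x → β / 2 * x ^ α ≤ c x ∧ c x ≤ 2 * β * x ^ α := by
    intro x hx
    have h2 := (hx₀ x hx).1
    have h3 : 0 < x ^ α := Real.rpow_pos_of_pos (by linarith) _
    have h4 : 0 < β * x ^ α := mul_pos hβ h3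
    simp only [Pi.sub_apply, Real.norm_eq_abs] at h2
    rw [abs_of_pos h4, abs_le] at h2
    constructor <;> linarith [h2.1, h2.2]
  have hone : ∀ x : ℝ, (1 : ℝ) ≤ (1 + |x|) ^ α := fun x =>
    Real.one_le_rpow (by linarith [abs_nonneg x]) hα.le
  have h2α : (0 : ℝ) < 2 ^ α := by positivity
  -- The first and third summands serve `|x| ≤ x₀`, the other two serve `|x| ≥ x₀`.
  set K : ℝ := c x₀ + 2 * β + (1 + x₀) ^ α + 2 ^ α * (2 / β) with hK
  have hK1 : 0 ≤ c x₀ := hc.nonneg _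
  have hK2 : (0 : ℝ) < (1 + x₀) ^ α := Real.rpow_pos_of_pos (by linarith) _
  have hK3 : 0 < 2 ^ α * (2 / β) := by positivity
  refine ⟨α, K, hα, by linarith, fun x => ?_, fun x => ?_⟩
  · rcases le_total |x| x₀ with hx | hx
    · have h5 : c x ≤ c x₀ := hc.mono _ _ (hx.trans (le_abs_self _))
      have h6 : K * 1 ≤ K * (1 + |x|) ^ α :=
        mul_le_mul_of_nonneg_left (hone x) (by linarith)
      linarith
    · have h5 := (hb _ hx).2
      rw [hc.map_abs] at h5
      have h6 : |x| ^ α ≤ (1 + |x|) ^ α :=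
        Real.rpow_le_rpow (abs_nonneg x) (by linarith) hα.le
      calc c x ≤ 2 * β * |x| ^ α := h5
        _ ≤ K * (1 + |x|) ^ α := by
          gcongr
          linarith
  · have h0 := hc.nonneg x
    rcases le_total |x| x₀ with hx | hx
    · have h5 : (1 + |x|) ^ α ≤ (1 + x₀) ^ α :=
        Real.rpow_le_rpow (by positivity) (by linarith) hα.le
      have h6 : K * 1 ≤ K * (1 + c x) :=
        mul_le_mul_of_nonneg_left (by linarith) (by linarith)
      linarith
    · have h5 := (hb _ hx).1
      rw [hc.map_abs] at h5
      have h6 : (1 + |x|) ^ α ≤ (2 * |x|) ^ α :=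
        Real.rpow_le_rpow (by positivity) (by linarith) hα.le
      rw [Real.mul_rpow (by norm_num) (abs_nonneg x)] at h6
      have h7 : |x| ^ α ≤ 2 / β * c x := by
        rw [div_mul_eq_mul_div, le_div_iff₀ hβ]
        linarith
      calc (1 + |x|) ^ α ≤ 2 ^ α * |x| ^ α := h6
        _ ≤ 2 ^ α * (2 / β * c x) := by gcongr
        _ = 2 ^ α * (2 / β) * c x := by ring
        _ ≤ K * (1 + c x) := by
          apply mul_le_mul <;> linarith

/-- The only consequences of the power tail needed later: translation changes the cost by a
polynomial factor, and logarithmic losses are paid for by the cost. -/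
theorem exists_growth (hc : IsCostFunction c) : ∃ (K : ℝ) (m : ℕ), 1 ≤ K ∧
    (∀ x y, c (x + y) ≤ K * (1 + c x) * (1 + |y|) ^ m) ∧
    ∀ x, Real.log (2 + |x|) ≤ K * (1 + c x) := by
  obtain ⟨α, K, hα, hK, h1, h2⟩ := hc.exists_rpow_bounds
  have hpos : ∀ x : ℝ, 0 < 1 + |x| := fun x => by positivity
  refine ⟨1 + K * K + 2 ^ α / α * K, ⌈α⌉₊, ?_, fun x y => ?_, fun x => ?_⟩
  · have : 0 < 2 ^ α / α * K := by positivity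
    nlinarith
  · have h0 := hc.nonneg x
    have h3 : (1 + |x + y|) ^ α ≤ (1 + |x|) ^ α * (1 + |y|) ^ α := by
      rw [← Real.mul_rpow (hpos x).le (hpos y).le]
      refine Real.rpow_le_rpow (hpos _).le ?_ hα.le
      nlinarith [abs_add_le x y, mul_nonneg (abs_nonneg x) (abs_nonneg y)]
    have h4 : (1 + |y|) ^ α ≤ (1 + |y|) ^ ⌈α⌉₊ := by
      rw [← Real.rpow_natCast]
      exact Real.rpow_le_rpow_of_exponent_le (by linarith [abs_nonneg y]) (Nat.le_ceil α)
    calc c (x + y) ≤ K * (1 + |x + y|) ^ α := h1 _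
      _ ≤ K * ((1 + |x|) ^ α * (1 + |y|) ^ α) := by gcongr
      _ ≤ K * ((K * (1 + c x)) * (1 + |y|) ^ ⌈α⌉₊) := by
        gcongr
        exact h2 x
      _ = K * K * (1 + c x) * (1 + |y|) ^ ⌈α⌉₊ := by ring
      _ ≤ _ := by
        gcongr
        have : 0 < 2 ^ α / α * K := by positivity
        linarith
  · have h0 := hc.nonneg x
    calc Real.log (2 + |x|) ≤ (2 + |x|) ^ α / α :=
          Real.log_le_rpow_div (by positivity) hα
      _ ≤ (2 * (1 + |x|)) ^ α / α := by
        gcongr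
        linarith [abs_nonneg x]
      _ = 2 ^ α / α * (1 + |x|) ^ α := by
        rw [Real.mul_rpow (by norm_num) (hpos x).le]
        ring
      _ ≤ 2 ^ α / α * (K * (1 + c x)) := by
        gcongr
        exact h2 x
      _ = 2 ^ α / α * K * (1 + c x) := by ring
      _ ≤ _ := by
        gcongr
        nlinarith

end IsCostFunction

/-! ### Laws with polynomial tails. -/

/-- The unnormalized density `(1 + |x|)^{-(m + 2)}`. -/
noncomputable def polyWeight (m : ℕ) (x : ℝ) : ℝ := ((1 + |x|) ^ (m + 2))⁻¹

theorem polyWeight_pos (m : ℕ) (x : ℝ) : 0 < polyWeight m x := by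
  unfold polyWeight
  positivity

@[fun_prop]
theorem measurable_polyWeight (m : ℕ) : Measurable (polyWeight m) := by
  unfold polyWeight
  fun_prop

theorem polyWeight_le_mul (m : ℕ) (x b : ℝ) :
    polyWeight m x ≤ (1 + |b|) ^ (m + 2) * polyWeight m (x - b) := by
  unfold polyWeight
  rw [← div_eq_mul_inv, le_div_iff₀ (by positivity), inv_mul_le_iff₀ (by positivity), ← mul_pow]
  gcongr
  nlinarith [abs_sub x b, mul_nonneg (abs_nonneg x) (abs_nonneg b)]

theorem integrable_inv_one_add_abs_sq : Integrable fun x : ℝ => ((1 + |x|) ^ 2)⁻¹ := by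
  have h := integrable_one_add_norm (E := ℝ) (μ := volume) (r := 2) (by simp)
  refine h.congr (ae_of_all _ fun x => ?_)
  simp only [Real.norm_eq_abs]
  rw [Real.rpow_neg (by positivity)]
  norm_cast

/-- This is the reason for the exponent `m + 2`: `m` powers absorb the growth of the cost and an
integrable inverse square remains. -/
theorem polyWeight_mul_pow (m : ℕ) (x : ℝ) :
    polyWeight m x * (1 + |x|) ^ m = ((1 + |x|) ^ 2)⁻¹ := by
  unfold polyWeight
  have : (0 : ℝ) < 1 + |x| := by positivity
  field_simp
  ring

theorem polyWeight_le_inv_sq (m : ℕ) (x : ℝ) : polyWeight m x ≤ ((1 + |x|) ^ 2)⁻¹ := by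
  rw [← polyWeight_mul_pow m]
  have : (1 : ℝ) ≤ (1 + |x|) ^ m := one_le_pow₀ (by linarith [abs_nonneg x])
  nlinarith [polyWeight_pos m x]

theorem integrable_polyWeight (m : ℕ) : Integrable (polyWeight m) :=
  integrable_inv_one_add_abs_sq.mono' (by fun_prop) (ae_of_all _ fun x => by
    rw [Real.norm_eq_abs, abs_of_pos (polyWeight_pos m x)]
    exact polyWeight_le_inv_sq m x)

theorem integral_polyWeight_pos (m : ℕ) : 0 < ∫ x, polyWeight m x := by
  rw [integral_pos_iff_support_of_nonneg (fun x => (polyWeight_pos m x).le)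
    (integrable_polyWeight m)]
  have : Function.support (polyWeight m) = Set.univ :=
    Set.eq_univ_of_forall fun x => (polyWeight_pos m x).ne'
  simp [this]

/-- The probability law with density proportional to `polyWeight m`. -/
noncomputable def polyLaw (m : ℕ) : Measure ℝ :=
  volume.withDensity fun x => ENNReal.ofReal (polyWeight m x / ∫ x, polyWeight m x)

instance (m : ℕ) : IsProbabilityMeasure (polyLaw m) := by
  constructor
  rw [polyLaw, withDensity_apply _ MeasurableSet.univ, Measure.restrict_univ,
    ← ofReal_integral_eq_lintegral_ofReal ((integrable_polyWeight m).div_const _)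
      (ae_of_all _ fun x => div_nonneg (polyWeight_pos m x).le (integral_polyWeight_pos m).le),
    integral_div, div_self (integral_polyWeight_pos m).ne', ENNReal.ofReal_one]

theorem polyLaw_le_smul_map (m : ℕ) (b : ℝ) :
    polyLaw m ≤ ENNReal.ofReal ((1 + |b|) ^ (m + 2)) • (polyLaw m).map (fun x => x + b) := by
  refine Measure.le_iff.2 fun s hs => ?_
  rw [Measure.smul_apply, Measure.map_apply (by fun_prop) hs, smul_eq_mul, polyLaw,
    withDensity_apply _ hs, withDensity_apply _ (hs.preimage (by fun_prop)),
    ← lintegral_const_mul _ (by fun_prop), ← lintegral_indicator hs,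
    ← lintegral_indicator (hs.preimage (by fun_prop)),
    ← lintegral_add_right_eq_self (fun x => s.indicator _ x) b]
  refine lintegral_mono fun x => ?_
  by_cases hx : x + b ∈ s
  · have hx' : x ∈ (fun x => x + b) ⁻¹' s := hx
    rw [Set.indicator_of_mem hx, Set.indicator_of_mem hx', ← ENNReal.ofReal_mul (by positivity)]
    refine ENNReal.ofReal_le_ofReal ?_
    rw [mul_div_assoc']
    have h := polyWeight_le_mul m (x + b) b
    rw [add_sub_cancel_right] at h
    exact div_le_div_of_nonneg_right h (integral_polyWeight_pos m).le
  · rw [Set.indicator_of_notMem hx]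
    exact zero_le

/-- The law of `L X` if `X` has law `polyLaw m`. -/
noncomputable def scaledPolyLaw (m : ℕ) (L : ℝ) : Measure ℝ :=
  (polyLaw m).map fun x => L * x

instance (m : ℕ) (L : ℝ) : IsProbabilityMeasure (scaledPolyLaw m L) :=
  Measure.isProbabilityMeasure_map (by fun_prop)

/-- Shifting `L X` by `a` shifts `X` by `a / L`. Large `L` gives nearly invariant input laws; small
`L` gives noise of small cost whose shift bound is still finite. -/
theorem shiftQuasiInvariant_scaledPolyLaw (m : ℕ) {L : ℝ} (hL : 0 < L) :
    ShiftQuasiInvariant (scaledPolyLaw m L) (Real.log ((1 + 1 / L) ^ (m + 2))) := by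
  intro a ha
  have hm : Measurable fun x : ℝ => L * x := by fun_prop
  have h2 : (scaledPolyLaw m L).map (fun x => x + a)
      = ((polyLaw m).map (fun x => x + a / L)).map fun x => L * x := by
    rw [scaledPolyLaw, Measure.map_map (by fun_prop) hm, Measure.map_map hm (by fun_prop)]
    congr 1 with x
    simp only [Function.comp_apply]
    field_simp
  rw [h2, Real.exp_log (by positivity)]
  refine Measure.le_iff.2 fun s hs => ?_
  rw [scaledPolyLaw, Measure.smul_apply, Measure.map_apply hm hs, Measure.map_apply hm hs]
  refine (polyLaw_le_smul_map m (a / L) _).trans ?_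
  rw [Measure.smul_apply, smul_eq_mul, smul_eq_mul]
  gcongr
  rw [abs_div, abs_of_pos hL]
  gcongr

theorem exists_shiftQuasiInvariant (m : ℕ) {l : ℝ} (hl : 0 < l) :
    ∃ μ : Measure ℝ, IsProbabilityMeasure μ ∧ ShiftQuasiInvariant μ l := by
  have h1 : Tendsto (fun L : ℝ => Real.log ((1 + 1 / L) ^ (m + 2))) atTop (𝓝 0) := by
    have h2 : Tendsto (fun L : ℝ => (1 + 1 / L) ^ (m + 2)) atTop (𝓝 ((1 + 0) ^ (m + 2))) :=
      ((tendsto_const_nhds).add (tendsto_const_nhds.div_atTop tendsto_id)).pow _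
    have := h2.log (by simp)
    simpa using this
  obtain ⟨L, hL, hL0⟩ := ((h1.eventually (gt_mem_nhds hl)).and (eventually_gt_atTop 0)).exists
  refine ⟨scaledPolyLaw m L, inferInstance, fun a ha => ?_⟩
  refine (shiftQuasiInvariant_scaledPolyLaw m hL0 a ha).trans ?_
  refine Measure.le_iff.2 fun s hs => ?_
  rw [Measure.smul_apply, Measure.smul_apply, smul_eq_mul, smul_eq_mul]
  gcongr

theorem IsCostFunction.expectedCost_polyLaw_lt_top {c : ℝ → ℝ} (hc : IsCostFunction c) {K : ℝ}
    {m : ℕ} (h : ∀ x y, c (x + y) ≤ K * (1 + c x) * (1 + |y|) ^ m) :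
    expectedCost c (polyLaw m) < ∞ := by
  have hcm := hc.continuous.measurable
  rw [expectedCost, polyLaw, lintegral_withDensity_eq_lintegral_mul _ (by fun_prop) (by fun_prop)]
  have hi := (integrable_inv_one_add_abs_sq.const_mul K).div_const (∫ x, polyWeight m x)
  refine lt_of_le_of_lt (lintegral_mono fun x => ?_) hi.lintegral_lt_top
  have hZ := integral_polyWeight_pos m
  have hw := polyWeight_pos m x
  rw [Pi.mul_apply, ← ENNReal.ofReal_mul (by positivity)]
  refine ENNReal.ofReal_le_ofReal ?_
  rw [div_mul_eq_mul_div]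
  refine div_le_div_of_nonneg_right ?_ hZ.le
  have h1 := h 0 x
  rw [zero_add, hc.map_zero, add_zero, mul_one] at h1
  rw [← polyWeight_mul_pow m]
  nlinarith

theorem IsCostFunction.exists_scaledPolyLaw_cost_le {c : ℝ → ℝ} (hc : IsCostFunction c) {K : ℝ}
    {m : ℕ} (h : ∀ x y, c (x + y) ≤ K * (1 + c x) * (1 + |y|) ^ m) {η : ℝ≥0∞} (hη : 0 < η) :
    ∃ L, 0 < L ∧ expectedCost c (scaledPolyLaw m L) ≤ η := by
  have hcm := hc.continuous.measurable
  have hlim : Tendsto (fun k : ℕ => expectedCost c (scaledPolyLaw m (1 / ((k : ℝ) + 1)))) atTop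
      (𝓝 (∫⁻ x, 0 ∂(polyLaw m))) := by
    have h1 : ∀ k : ℕ, expectedCost c (scaledPolyLaw m (1 / ((k : ℝ) + 1)))
        = ∫⁻ x, ENNReal.ofReal (c (1 / ((k : ℝ) + 1) * x)) ∂(polyLaw m) := fun k => by
      rw [expectedCost, scaledPolyLaw, lintegral_map (by fun_prop) (by fun_prop)]
    simp only [h1]
    refine tendsto_lintegral_of_dominated_convergence (fun x => ENNReal.ofReal (c x))
      (fun k => by fun_prop) (fun k => ae_of_all _ fun x => ?_)
      (hc.expectedCost_polyLaw_lt_top h).ne (ae_of_all _ fun x => ?_)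
    · refine ENNReal.ofReal_le_ofReal (hc.mono _ _ ?_)
      rw [abs_mul, abs_of_pos (by positivity)]
      refine mul_le_of_le_one_left (abs_nonneg x) ?_
      rw [div_le_one (by positivity)]
      linarith [(Nat.cast_nonneg k : (0 : ℝ) ≤ k)]
    · have h2 : Tendsto (fun k : ℕ => 1 / ((k : ℝ) + 1) * x) atTop (𝓝 0) := by
        simpa using (tendsto_one_div_add_atTop_nhds_zero_nat (𝕜 := ℝ)).mul_const x
      have h3 := (hc.continuous.tendsto 0).comp h2
      rw [hc.map_zero] at h3
      simpa using ENNReal.tendsto_ofReal h3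
  rw [lintegral_zero] at hlim
  obtain ⟨k, hk⟩ := (hlim.eventually (gt_mem_nhds hη)).exists
  exact ⟨_, by positivity, hk.le⟩

/-! ### Divergence of measures given by densities. -/

/-- The contribution `a log (a / b) + b - a` of a pair of densities to the divergence. -/
noncomputable def klTerm (a b : ℝ) : ℝ := b * klFun (a / b)

theorem klTerm_eq {a b : ℝ} (hb : 0 < b) :
    klTerm a b = a * Real.log (a / b) + b - a := by
  rw [klTerm, klFun_apply]
  field_simp

/-- Thanks to the correction `b - a` every single term is nonnegative, so sums and integrals of
terms live in `[0, ∞]` without summability conditions. -/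
theorem klTerm_nonneg {a b : ℝ} (ha : 0 ≤ a) (hb : 0 ≤ b) : 0 ≤ klTerm a b :=
  mul_nonneg hb (klFun_nonneg (div_nonneg ha hb))

theorem klTerm_mul_mul {t : ℝ} (ht : 0 < t) (a b : ℝ) : klTerm (t * a) (t * b) = t * klTerm a b := by
  rw [klTerm, klTerm, mul_div_mul_left _ _ ht.ne', mul_assoc]

theorem klDiv_withDensity {α : Type*} [MeasurableSpace α] (μ : Measure α) {f g : α → ℝ}
    (hf : Measurable f) (hg : Measurable g) (hf0 : ∀ x, 0 < f x) (hg0 : ∀ x, 0 < g x)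
    [IsFiniteMeasure (μ.withDensity fun x => ENNReal.ofReal (f x))]
    [IsFiniteMeasure (μ.withDensity fun x => ENNReal.ofReal (g x))] :
    klDiv (μ.withDensity fun x => ENNReal.ofReal (f x)) (μ.withDensity fun x => ENNReal.ofReal (g x))
      = ∫⁻ x, ENNReal.ofReal (klTerm (f x) (g x)) ∂μ := by
  have h1 : (μ.withDensity fun x => ENNReal.ofReal (f x))
      = (μ.withDensity fun x => ENNReal.ofReal (g x)).withDensity
        fun x => ENNReal.ofReal (f x / g x) := by
    rw [← withDensity_mul _ (by fun_prop) (by fun_prop)]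
    congr 1 with x
    rw [Pi.mul_apply, ← ENNReal.ofReal_mul (hg0 x).le, mul_div_cancel₀ _ (hg0 x).ne']
  have h2 := Measure.rnDeriv_withDensity (μ.withDensity fun x => ENNReal.ofReal (g x))
    (f := fun x => ENNReal.ofReal (f x / g x)) (by fun_prop)
  rw [← h1] at h2
  have hac : (μ.withDensity fun x => ENNReal.ofReal (f x))
      ≪ μ.withDensity fun x => ENNReal.ofReal (g x) := by
    rw [h1]
    exact withDensity_absolutelyContinuous _ _
  have h3 : ∫⁻ x, ENNReal.ofReal (klFun ((μ.withDensity fun x => ENNReal.ofReal (f x)).rnDeriv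
      (μ.withDensity fun x => ENNReal.ofReal (g x)) x).toReal)
        ∂(μ.withDensity fun x => ENNReal.ofReal (g x))
      = ∫⁻ x, ENNReal.ofReal (klFun (f x / g x)) ∂(μ.withDensity fun x => ENNReal.ofReal (g x)) := by
    refine lintegral_congr_ae ?_
    filter_upwards [h2] with x hx
    rw [hx, ENNReal.toReal_ofReal (div_nonneg (hf0 x).le (hg0 x).le)]
  rw [klDiv_eq_lintegral_klFun_of_ac hac, h3,
    lintegral_withDensity_eq_lintegral_mul _ (by fun_prop) (by fun_prop)]
  refine lintegral_congr fun x => ?_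
  rw [Pi.mul_apply, ← ENNReal.ofReal_mul (hg0 x).le, klTerm]

theorem shiftMeasure_withDensity (a : ℝ) (f : ℝ → ℝ≥0∞) :
    shiftMeasure a (volume.withDensity f) = volume.withDensity fun x => f (x - a) := by
  refine Measure.ext fun s hs => ?_
  rw [shiftMeasure, Measure.map_apply (by fun_prop) hs, withDensity_apply _ hs,
    withDensity_apply _ (hs.preimage (by fun_prop)), ← lintegral_indicator hs,
    ← lintegral_indicator (hs.preimage (by fun_prop)),
    ← lintegral_add_right_eq_self (fun x => s.indicator _ x) a]
  refine lintegral_congr fun x => ?_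
  by_cases hx : x + a ∈ s
  · rw [Set.indicator_of_mem hx, Set.indicator_of_mem (show x ∈ (fun x => x + a) ⁻¹' s from hx),
      add_sub_cancel_right]
  · rw [Set.indicator_of_notMem hx,
      Set.indicator_of_notMem (show x ∉ (fun x => x + a) ⁻¹' s from hx)]

/-! ### Lattice measures. -/

theorem lintegral_eq_lintegral_tsum {T : ℝ} (hT : 0 < T) {G : ℝ → ℝ≥0∞} (hG : Measurable G) :
    ∫⁻ x, G x = ∫⁻ x in Set.Ioc 0 T, ∑' m : ℤ, G (x + m * T) := by
  have h1 := iUnion_Ioc_add_zsmul hT 0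
  have h2 := Set.pairwise_disjoint_Ioc_add_zsmul (0 : ℝ) T
  rw [← setLIntegral_univ, ← h1, lintegral_iUnion (fun _ => measurableSet_Ioc) h2,
    lintegral_tsum fun m => by fun_prop]
  refine tsum_congr fun m => ?_
  rw [← lintegral_indicator measurableSet_Ioc, ← lintegral_indicator measurableSet_Ioc,
    ← lintegral_add_right_eq_self (fun x => Set.indicator _ _ x) (m * T)]
  refine lintegral_congr fun x => ?_
  have hiff : x + m * T ∈ Set.Ioc (0 + m • T) (0 + (m + 1) • T) ↔ x ∈ Set.Ioc 0 T := by
    simp only [Set.mem_Ioc, zsmul_eq_mul, Int.cast_add, Int.cast_one]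
    constructor <;> rintro ⟨h3, h4⟩ <;> constructor <;> linarith
  by_cases hx : x ∈ Set.Ioc 0 T
  · rw [Set.indicator_of_mem hx, Set.indicator_of_mem (hiff.2 hx)]
  · rw [Set.indicator_of_notMem hx, Set.indicator_of_notMem (mt hiff.1 hx)]

/-- The index of the lattice point of `ℤ / n` closest to `x`. -/
noncomputable def latticeIndex (n : ℕ) (x : ℝ) : ℤ := ⌊n * x + 1 / 2⌋

@[fun_prop]
theorem measurable_latticeIndex (n : ℕ) : Measurable (latticeIndex n) := by
  unfold latticeIndex
  fun_prop

theorem latticeIndex_add_div {n : ℕ} (hn : 0 < n) (x : ℝ) (m : ℤ) :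
    latticeIndex n (x + m / n) = latticeIndex n x + m := by
  have hn' : (n : ℝ) ≠ 0 := by exact_mod_cast hn.ne'
  rw [latticeIndex, latticeIndex, ← Int.floor_add_intCast]
  congr 1
  field_simp
  ring

/-- The index difference is an integer smaller than `n + 1` in absolute value, so real shifts by at
most `1` produce only index shifts by at most `n`. -/
theorem abs_latticeIndex_sub_le {n : ℕ} (x : ℝ) {a : ℝ} (ha : |a| ≤ 1) :
    |latticeIndex n x - latticeIndex n (x - a)| ≤ n := by
  have h1 := Int.floor_le (n * x + 1 / 2)
  have h2 := Int.lt_floor_add_one (n * x + 1 / 2)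
  have h3 := Int.floor_le (n * (x - a) + 1 / 2)
  have h4 := Int.lt_floor_add_one (n * (x - a) + 1 / 2)
  obtain ⟨h5, h6⟩ := abs_le.1 ha
  have hn : (0 : ℝ) ≤ n := Nat.cast_nonneg n
  have h7 : -(n : ℝ) ≤ n * a := by nlinarith
  have h8 : n * a ≤ n := by nlinarith
  have h9 : (latticeIndex n x - latticeIndex n (x - a) : ℝ) < n + 1 := by
    unfold latticeIndex
    linarith
  have h10 : -(n + 1 : ℝ) < latticeIndex n x - latticeIndex n (x - a) := by
    unfold latticeIndex
    linarith
  have h11 : latticeIndex n x - latticeIndex n (x - a) < (n : ℤ) + 1 := by exact_mod_cast h9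
  have h12 : -((n : ℤ) + 1) < latticeIndex n x - latticeIndex n (x - a) := by exact_mod_cast h10
  rw [abs_le]
  omega

theorem abs_le_of_latticeIndex {n : ℕ} (hn : 0 < n) (x : ℝ) :
    |x| ≤ (|(latticeIndex n x : ℝ)| + 1) / n := by
  have hn' : (0 : ℝ) < n := by exact_mod_cast hn
  have h1 := Int.floor_le (n * x + 1 / 2)
  have h2 := Int.lt_floor_add_one (n * x + 1 / 2)
  have h5 : |x| * n = |n * x| := by rw [abs_mul, abs_of_pos hn', mul_comm]
  rw [le_div_iff₀ hn', h5, latticeIndex]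
  have h3 := neg_abs_le (⌊n * x + 1 / 2⌋ : ℝ)
  have h4 := le_abs_self (⌊n * x + 1 / 2⌋ : ℝ)
  exact abs_le.2 ⟨by linarith, by linarith⟩

theorem abs_latticeIndex_add_one_div_le {n : ℕ} (hn : 0 < n) (x : ℝ) :
    (|(latticeIndex n x : ℝ)| + 1) / n ≤ |x| + 2 / n := by
  have hn' : (0 : ℝ) < n := by exact_mod_cast hn
  have h1 := Int.floor_le (n * x + 1 / 2)
  have h2 := Int.lt_floor_add_one (n * x + 1 / 2)
  have h5 : (|x| + 2 / n) * n = |n * x| + 2 := by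
    rw [abs_mul, abs_of_pos hn']
    field_simp
  rw [div_le_iff₀ hn', h5, latticeIndex]
  have h3 := neg_abs_le (n * x)
  have h4 := le_abs_self (n * x)
  have : |(⌊n * x + 1 / 2⌋ : ℝ)| ≤ |n * x| + 1 := abs_le.2 ⟨by linarith, by linarith⟩
  linarith

/-- Moving `x` by a multiple of `1/n` moves both indices equally, so their difference depends only
on the position of `x` within one period. -/
theorem lintegral_comp_latticeIndex₂ {n : ℕ} (hn : 0 < n) (h : ℤ → ℤ → ℝ≥0∞) (a : ℝ) :
    ∫⁻ x, h (latticeIndex n x) (latticeIndex n (x - a))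
      = ∫⁻ x in Set.Ioc 0 (1 / (n : ℝ)),
        ∑' i : ℤ, h i (i - (latticeIndex n x - latticeIndex n (x - a))) := by
  have hn' : (0 : ℝ) < n := by exact_mod_cast hn
  have hm : Measurable fun x => h (latticeIndex n x) (latticeIndex n (x - a)) := by
    have h1 : Measurable (Function.uncurry h) := measurable_of_countable _
    exact h1.comp ((measurable_latticeIndex n).prodMk
      ((measurable_latticeIndex n).comp (measurable_id.sub_const a)))
  rw [lintegral_eq_lintegral_tsum (one_div_pos.2 hn') hm]
  refine lintegral_congr fun x => ?_
  refine Eq.trans (tsum_congr fun m => ?_) ((Equiv.addRight (latticeIndex n x)).tsum_eq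
    fun i => h i (i - (latticeIndex n x - latticeIndex n (x - a))))
  rw [mul_one_div, latticeIndex_add_div hn, show x + m / n - a = (x - a) + m / n by ring,
    latticeIndex_add_div hn, Equiv.coe_addRight]
  congr 1 <;> ring

theorem lintegral_comp_latticeIndex {n : ℕ} (hn : 0 < n) (h : ℤ → ℝ≥0∞) :
    ∫⁻ x, h (latticeIndex n x) = ENNReal.ofReal (1 / n) * ∑' i, h i := by
  rw [lintegral_comp_latticeIndex₂ hn (fun i _ => h i) 0, setLIntegral_const, Real.volume_Ioc,
    sub_zero, mul_comm]

/-- The measure that gives mass `q i` to the cell around `i / n`, uniformly distributed. -/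
noncomputable def latticeMeasure (n : ℕ) (q : ℤ → ℝ) : Measure ℝ :=
  volume.withDensity fun x => ENNReal.ofReal (n * q (latticeIndex n x))

theorem measurable_comp_latticeIndex {β : Type*} [MeasurableSpace β] (n : ℕ) (q : ℤ → β) :
    Measurable fun x => q (latticeIndex n x) :=
  (measurable_of_countable q).comp (measurable_latticeIndex n)

theorem lintegral_latticeMeasure {n : ℕ} (hn : 0 < n) (q : ℤ → ℝ) (h : ℤ → ℝ≥0∞) :
    ∫⁻ x, h (latticeIndex n x) ∂(latticeMeasure n q) = ∑' i, ENNReal.ofReal (q i) * h i := by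
  have hn' : (0 : ℝ) < n := by exact_mod_cast hn
  have hm := measurable_comp_latticeIndex n q
  rw [latticeMeasure, lintegral_withDensity_eq_lintegral_mul _ (by fun_prop)
    (measurable_comp_latticeIndex n h)]
  simp only [Pi.mul_apply]
  rw [lintegral_comp_latticeIndex hn (fun i => ENNReal.ofReal (n * q i) * h i),
    ← ENNReal.tsum_mul_left]
  refine tsum_congr fun i => ?_
  rw [← mul_assoc, ← ENNReal.ofReal_mul (by positivity)]
  congr 2
  field_simp

theorem isProbabilityMeasure_latticeMeasure {n : ℕ} (hn : 0 < n) {q : ℤ → ℝ} (hq : ∀ i, 0 ≤ q i)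
    (hs : HasSum q 1) : IsProbabilityMeasure (latticeMeasure n q) := by
  constructor
  have h1 := lintegral_latticeMeasure hn q fun _ => 1
  simp only [lintegral_one, mul_one] at h1
  rw [h1, ← ENNReal.ofReal_tsum_of_nonneg hq hs.summable, hs.tsum_eq, ENNReal.ofReal_one]

/-- The point `(|i| + 1) / n` dominates `|x|` on the whole cell and exceeds it by at most `2 / n`,
so quantisation only perturbs the argument of `c`. -/
theorem expectedCost_latticeMeasure_le {c : ℝ → ℝ} (hc : IsCostFunction c) {n : ℕ} (hn : 0 < n)
    (q : ℤ → ℝ) : expectedCost c (latticeMeasure n q)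
      ≤ ∑' i : ℤ, ENNReal.ofReal (q i) * ENNReal.ofReal (c ((|(i : ℝ)| + 1) / n)) := by
  rw [← lintegral_latticeMeasure hn q fun i => ENNReal.ofReal (c ((|(i : ℝ)| + 1) / n))]
  refine lintegral_mono fun x => ENNReal.ofReal_le_ofReal (hc.mono _ _ ?_)
  exact (abs_le_of_latticeIndex hn x).trans (le_abs_self _)

/-- For each position within a period, `T_a` acts as an index shift by some `j` with `|j| ≤ n`. The
divergence is thus an average of discrete divergences. -/
theorem klDiv_latticeMeasure_le {n : ℕ} (hn : 0 < n) {q : ℤ → ℝ} (hq : ∀ i, 0 < q i)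
    (hs : HasSum q 1) {W : ℝ≥0∞}
    (hW : ∀ j : ℤ, |j| ≤ n → ∑' i, ENNReal.ofReal (klTerm (q i) (q (i - j))) ≤ W)
    {a : ℝ} (ha : |a| ≤ 1) :
    klDiv (latticeMeasure n q) (shiftMeasure a (latticeMeasure n q)) ≤ W := by
  have hn' : (0 : ℝ) < n := by exact_mod_cast hn
  have hP := isProbabilityMeasure_latticeMeasure hn (fun i => (hq i).le) hs
  have hP' : IsProbabilityMeasure (shiftMeasure a (latticeMeasure n q)) :=
    Measure.isProbabilityMeasure_map (by fun_prop)
  have hm := measurable_comp_latticeIndex n q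
  have hm' : Measurable fun x => q (latticeIndex n (x - a)) :=
    hm.comp (measurable_id.sub_const a)
  have hsm := shiftMeasure_withDensity a fun x => ENNReal.ofReal (n * q (latticeIndex n x))
  rw [latticeMeasure] at hP hP' ⊢
  rw [hsm] at hP' ⊢
  rw [klDiv_withDensity volume (by fun_prop) (by fun_prop) (fun x => mul_pos hn' (hq _))
    (fun x => mul_pos hn' (hq _)), lintegral_comp_latticeIndex₂ hn
      (fun i k => ENNReal.ofReal (klTerm (n * q i) (n * q k))) a]
  calc _ ≤ ∫⁻ x in Set.Ioc 0 (1 / (n : ℝ)), ENNReal.ofReal n * W := by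
        refine lintegral_mono fun x => ?_
        simp only [klTerm_mul_mul hn', ENNReal.ofReal_mul hn'.le]
        rw [ENNReal.tsum_mul_left]
        gcongr
        exact hW _ (abs_latticeIndex_sub_le x ha)
    _ = W := by
        rw [setLIntegral_const, Real.volume_Ioc, sub_zero, mul_right_comm,
          ← ENNReal.ofReal_mul hn'.le, mul_one_div_cancel hn'.ne', ENNReal.ofReal_one, one_mul]

/-! ### Cactus measures as lattice measures. -/

/-- The mass that `P_{n,r,p}` gives to the cells `J_{n,i}` with `|i| = k`. -/
noncomputable def cactusCoeff (N : ℕ) (r : ℝ) (p : Fin (N + 1) → ℝ) (k : ℕ) : ℝ :=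
  if h : k < N then p ⟨k, by omega⟩ else p (Fin.last N) * r ^ (k - N)

theorem cactusValue_eq (n N : ℕ) (r : ℝ) (p : Fin (N + 1) → ℝ) (k : ℕ) :
    cactusValue n N r p k = n * cactusCoeff N r p k := by
  unfold cactusValue cactusCoeff
  split_ifs
  · rfl
  · ring

theorem mem_cactusCell_latticeIndex {n : ℕ} (hn : 0 < n) {x : ℝ}
    (hx : ∀ k : ℤ, n * x + 1 / 2 ≠ k) : x ∈ cactusCell n (latticeIndex n x) := by
  have hn' : (0 : ℝ) < n := by exact_mod_cast hn
  have h1 := (Int.floor_le (n * x + 1 / 2)).lt_of_ne (hx _).symm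
  have h2 := Int.lt_floor_add_one (n * x + 1 / 2)
  have h3 : (⌊n * x + 1 / 2⌋ - 1 / 2 : ℝ) / n < x := by
    rw [div_lt_iff₀ hn']
    linarith
  have h4 : x < (⌊n * x + 1 / 2⌋ + 1 / 2 : ℝ) / n := by
    rw [lt_div_iff₀ hn']
    linarith
  unfold cactusCell latticeIndex
  split_ifs with h0 h5
  · rw [h0] at h3 h4
    constructor
    · refine le_trans (le_of_eq ?_) h3.le
      push_cast
      field_simp
      ring
    · refine le_trans h4.le (le_of_eq ?_)
      push_cast
      field_simp
      ring
  · exact ⟨h3, h4.le⟩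
  · exact ⟨h3.le, h4⟩

theorem cactusMeasure_eq_latticeMeasure {n : ℕ} (hn : 0 < n) (N : ℕ) (r : ℝ)
    (p : Fin (N + 1) → ℝ) :
    cactusMeasure n N r p = latticeMeasure n fun i => cactusCoeff N r p i.natAbs := by
  have hn' : (0 : ℝ) < n := by exact_mod_cast hn
  refine withDensity_congr_ae ?_
  -- The conventions for the cells can disagree only at their endpoints, a countable set.
  have h1 : (Set.range fun k : ℤ => ((k : ℝ) - 1 / 2) / n).Countable := Set.countable_range _
  have h2 : ∀ᵐ x : ℝ, x ∉ Set.range fun k : ℤ => ((k : ℝ) - 1 / 2) / n :=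
    measure_eq_zero_iff_ae_notMem.1 (h1.measure_zero volume)
  filter_upwards [h2] with x hx
  rw [cactusDensity_of_mem_cell hn N r p (mem_cactusCell_latticeIndex hn fun k hk => hx ⟨k, ?_⟩),
    cactusValue_eq]
  rw [div_eq_iff hn'.ne']
  linarith

theorem cactusMass_eq {N : ℕ} (hN : 0 < N) (r : ℝ) (p : Fin (N + 1) → ℝ) :
    cactusMass N r p = 2 * (∑ k ∈ Finset.range N, cactusCoeff N r p k
      + p (Fin.last N) / (1 - r)) - cactusCoeff N r p 0 := by
  have h0 : cactusCoeff N r p 0 = p 0 := by simp [cactusCoeff, hN]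
  have h1 : ∑ k ∈ Finset.range N, cactusCoeff N r p k = ∑ i : Fin N, p i.castSucc := by
    rw [Finset.sum_range]
    refine Finset.sum_congr rfl fun i _ => ?_
    simp only [cactusCoeff, i.2, dif_pos]
    rfl
  have h2 : ∑ i, p i = ∑ i : Fin N, p i.castSucc + p (Fin.last N) := Fin.sum_univ_castSucc p
  have hlt : (0 : Fin (N + 1)) < Fin.last N := Fin.lt_def.2 hN
  have h3 : (Finset.univ : Finset (Fin (N + 1)))
      = insert 0 (insert (Fin.last N) (Finset.Ioo 0 (Fin.last N))) := by
    ext i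
    simp only [Finset.mem_univ, Finset.mem_insert, Finset.mem_Ioo, true_iff]
    rcases (Fin.zero_le i).eq_or_lt with h | h
    · exact Or.inl h.symm
    · rcases (Fin.le_last i).eq_or_lt with h' | h'
      · exact Or.inr (Or.inl h')
      · exact Or.inr (Or.inr ⟨h, h'⟩)
  have h4 : ∑ i, p i = p 0 + (p (Fin.last N) + ∑ i ∈ Finset.Ioo 0 (Fin.last N), p i) := by
    rw [h3, Finset.sum_insert (by simp [hlt.ne]), Finset.sum_insert (by simp)]
  rw [cactusMass, ← Finset.mul_sum, h1, h0]
  have h5 : ∑ i : Fin N, p i.castSucc = p 0 + ∑ i ∈ Finset.Ioo 0 (Fin.last N), p i := by linarith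
  rw [h5]
  ring

theorem hasSum_int_of_even {f : ℕ → ℝ} {s : ℝ} (hf : HasSum f s) :
    HasSum (fun i : ℤ => f i.natAbs) (2 * s - f 0) := by
  have h1 : HasSum (fun k : ℕ => f (k + 1)) (s - f 0) := by
    simpa using (hasSum_nat_add_iff' 1).2 hf
  have h2 : HasSum (fun k : ℕ => f ((-((k : ℤ) + 1)).natAbs)) (s - f 0) := by
    have h4 : ∀ k : ℕ, (-((k : ℤ) + 1)).natAbs = k + 1 := fun k => by omega
    simpa only [h4] using h1
  have h3 : HasSum (fun k : ℕ => f ((k : ℤ).natAbs)) s := by simpa using hf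
  have := HasSum.of_nat_of_neg_add_one (f := fun i : ℤ => f i.natAbs) h3 h2
  convert this using 1
  ring

theorem hasSum_cactusCoeff (N : ℕ) {r : ℝ} (h0 : 0 ≤ r) (h1 : r < 1) (p : Fin (N + 1) → ℝ) :
    HasSum (cactusCoeff N r p)
      (∑ k ∈ Finset.range N, cactusCoeff N r p k + p (Fin.last N) / (1 - r)) := by
  rw [add_comm]
  refine (hasSum_nat_add_iff N).1 ?_
  have h2 : (fun k => cactusCoeff N r p (k + N)) = fun k => p (Fin.last N) * r ^ k := by
    ext k
    simp [cactusCoeff]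
  rw [h2, div_eq_mul_inv]
  exact (hasSum_geometric_of_lt_one h0 h1).mul_left _

theorem hasSum_cactusCoeff_natAbs {N : ℕ} (hN : 0 < N) {r : ℝ} (h0 : 0 ≤ r) (h1 : r < 1)
    (p : Fin (N + 1) → ℝ) :
    HasSum (fun i : ℤ => cactusCoeff N r p i.natAbs) (cactusMass N r p) := by
  rw [cactusMass_eq hN]
  exact hasSum_int_of_even (hasSum_cactusCoeff N h0 h1 p)

theorem isProbabilityMeasure_of_mem_cactusClass {n N : ℕ} (hn : 0 < n) (hN : 0 < N) {r : ℝ}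
    (hr : r ∈ Set.Ioo (0 : ℝ) 1) {P : Measure ℝ} (hP : P ∈ cactusClass n N r) :
    IsProbabilityMeasure P := by
  obtain ⟨p, hp, hmass, rfl⟩ := hP
  rw [cactusMeasure_eq_latticeMeasure hn]
  refine isProbabilityMeasure_latticeMeasure hn (fun i => ?_) ?_
  · unfold cactusCoeff
    split_ifs
    · exact (hp _).1
    · exact mul_nonneg (hp _).1 (pow_nonneg hr.1.le _)
  · rw [← hmass]
    exact hasSum_cactusCoeff_natAbs hN hr.1.le hr.2 p

/-! ### Quantisation and symmetrisation. -/

/-- The mass of the lattice cell with index `i`. -/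
noncomputable def cellMass (n : ℕ) (P : Measure ℝ) (i : ℤ) : ℝ :=
  P.real (latticeIndex n ⁻¹' {i})

theorem cellMass_nonneg (n : ℕ) (P : Measure ℝ) (i : ℤ) : 0 ≤ cellMass n P i :=
  measureReal_nonneg

theorem measurableSet_cell (n : ℕ) (i : ℤ) : MeasurableSet (latticeIndex n ⁻¹' {i}) :=
  measurable_latticeIndex n (measurableSet_singleton i)

theorem lintegral_comp_latticeIndex_eq_tsum (n : ℕ) (P : Measure ℝ) [IsProbabilityMeasure P]
    (h : ℤ → ℝ≥0∞) :
    ∫⁻ x, h (latticeIndex n x) ∂P = ∑' i, ENNReal.ofReal (cellMass n P i) * h i := by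
  rw [← lintegral_map (measurable_of_countable h) (measurable_latticeIndex n), lintegral_countable']
  refine tsum_congr fun i => ?_
  rw [Measure.map_apply (measurable_latticeIndex n) (measurableSet_singleton i), cellMass,
    ofReal_measureReal, mul_comm]

theorem hasSum_cellMass (n : ℕ) (P : Measure ℝ) [IsProbabilityMeasure P] :
    HasSum (cellMass n P) 1 := by
  have h1 := lintegral_comp_latticeIndex_eq_tsum n P fun _ => 1
  simp only [lintegral_one, measure_univ, mul_one] at h1
  have h2 := ENNReal.hasSum_toReal (f := fun i => ENNReal.ofReal (cellMass n P i))
    (by rw [← h1]; exact ENNReal.one_ne_top)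
  rw [← ENNReal.tsum_toReal_eq (fun _ => ENNReal.ofReal_ne_top), ← h1, ENNReal.toReal_one] at h2
  simpa only [ENNReal.toReal_ofReal (cellMass_nonneg n P _)] using h2

theorem integral_sum_indicator_cell (n : ℕ) (P : Measure ℝ) [IsProbabilityMeasure P]
    (F : Finset ℤ) (t : ℤ → ℝ) :
    ∫ x, ∑ i ∈ F, (latticeIndex n ⁻¹' {i}).indicator (fun _ => t i) x ∂P
      = ∑ i ∈ F, cellMass n P i * t i := by
  rw [integral_finsetSum F fun i _ => (integrable_const _).indicator (measurableSet_cell n i)]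
  refine Finset.sum_congr rfl fun i _ => ?_
  rw [integral_indicator_const _ (measurableSet_cell n i), smul_eq_mul, cellMass]

theorem sum_indicator_cell (n : ℕ) (F : Finset ℤ) (t : ℤ → ℝ) (x : ℝ) :
    ∑ i ∈ F, (latticeIndex n ⁻¹' {i}).indicator (fun _ => t i) x
      = if latticeIndex n x ∈ F then t (latticeIndex n x) else 0 := by
  have h1 : ∀ i, (latticeIndex n ⁻¹' {i}).indicator (fun _ => t i) x
      = if latticeIndex n x = i then t i else 0 := fun i => by
    by_cases h : latticeIndex n x = i
    · rw [if_pos h, Set.indicator_of_mem (show x ∈ latticeIndex n ⁻¹' {i} from h)]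
    · rw [if_neg h, Set.indicator_of_notMem (show x ∉ latticeIndex n ⁻¹' {i} from h)]
  simp only [h1]
  exact Finset.sum_ite_eq F _ t

/-- Test with functions constant on the cells of `F` and zero elsewhere: `exp f - 1` then vanishes
off these cells, leaving finite sums. -/
theorem ShiftBound.sum_cellMass_le {P : Measure ℝ} [IsProbabilityMeasure P] {V : ℝ}
    (h : ShiftBound P V) {n : ℕ} (hn : 0 < n) {j : ℤ} (hj : |j| ≤ n) (F : Finset ℤ) (t : ℤ → ℝ) :
    ∑ i ∈ F, cellMass n P i * t i
      ≤ V + ∑ i ∈ F, cellMass n P (i - j) * (Real.exp (t i) - 1) := by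
  have hn' : (0 : ℝ) < n := by exact_mod_cast hn
  have ha : |(j : ℝ) / n| ≤ 1 := by
    rw [abs_div, abs_of_pos hn', div_le_one hn']
    exact_mod_cast hj
  set f : ℝ → ℝ := fun x => if latticeIndex n x ∈ F then t (latticeIndex n x) else 0 with hf
  have hfm : Measurable f :=
    measurable_comp_latticeIndex n fun i => if i ∈ F then t i else 0
  have hfB : ∃ B, ∀ x, |f x| ≤ B := by
    refine ⟨∑ i ∈ F, |t i|, fun x => ?_⟩
    simp only [hf]
    split_ifs with hx
    · exact Finset.single_le_sum (f := fun i => |t i|) (fun i _ => abs_nonneg _) hx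
    · rw [abs_zero]
      exact Finset.sum_nonneg fun i _ => abs_nonneg _
  have h1 := h (j / n) ha f hfm hfB
  have h2 : ∫ x, f x ∂P = ∑ i ∈ F, cellMass n P i * t i := by
    rw [← integral_sum_indicator_cell]
    simp only [sum_indicator_cell, hf]
  have h3 : ∀ x, Real.exp (f (x + j / n)) = 1 + ∑ i ∈ F.map (Equiv.subRight j).toEmbedding,
      (latticeIndex n ⁻¹' {i}).indicator (fun _ => Real.exp (t (i + j)) - 1) x := by
    intro x
    rw [sum_indicator_cell n _ (fun i => Real.exp (t (i + j)) - 1)]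
    simp only [hf, latticeIndex_add_div hn]
    have h4 : latticeIndex n x ∈ F.map (Equiv.subRight j).toEmbedding
        ↔ latticeIndex n x + j ∈ F := by
      rw [Finset.mem_map_equiv]
      rfl
    by_cases h5 : latticeIndex n x + j ∈ F
    · rw [if_pos h5, if_pos (h4.2 h5)]
      ring
    · rw [if_neg h5, if_neg (mt h4.1 h5)]
      simp
  have h6 : ∫ x, Real.exp (f (x + j / n)) ∂P
      = 1 + ∑ i ∈ F, cellMass n P (i - j) * (Real.exp (t i) - 1) := by
    simp only [h3]
    rw [integral_add (integrable_const _), integral_sum_indicator_cell n P _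
      (fun i => Real.exp (t (i + j)) - 1), Finset.sum_map]
    · simp
    · exact integrable_finsetSum _ fun i _ =>
        (integrable_const _).indicator (measurableSet_cell n i)
  rw [h2, h6] at h1
  linarith

/-- The mass of the cells with index `± k`, averaged. -/
noncomputable def symmCellMass (n : ℕ) (P : Measure ℝ) (k : ℕ) : ℝ :=
  (cellMass n P k + cellMass n P (-k)) / 2

theorem symmCellMass_natAbs (n : ℕ) (P : Measure ℝ) (i : ℤ) :
    symmCellMass n P i.natAbs = (cellMass n P i + cellMass n P (-i)) / 2 := by
  rcases Int.natAbs_eq i with h | h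
  · rw [symmCellMass, ← h]
  · have h' : (i.natAbs : ℤ) = -i := by omega
    rw [symmCellMass, h', neg_neg, add_comm]

theorem hasSum_symmCellMass_natAbs (n : ℕ) (P : Measure ℝ) [IsProbabilityMeasure P] :
    HasSum (fun i : ℤ => symmCellMass n P i.natAbs) 1 := by
  have h1 := hasSum_cellMass n P
  have h2 : HasSum (cellMass n P ∘ Equiv.neg ℤ) 1 := (Equiv.neg ℤ).hasSum_iff.2 h1
  have h3 : HasSum (fun i => (cellMass n P i + cellMass n P (-i)) / 2) ((1 + 1) / 2) :=
    (h1.add h2).div_const 2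
  have h4 : ((1 : ℝ) + 1) / 2 = 1 := by norm_num
  rw [h4] at h3
  have h5 : (fun i : ℤ => symmCellMass n P i.natAbs)
      = fun i => (cellMass n P i + cellMass n P (-i)) / 2 := funext (symmCellMass_natAbs n P)
  rw [h5]
  exact h3

theorem tsum_symmCellMass_mul (n : ℕ) (P : Measure ℝ) [IsProbabilityMeasure P] (h : ℕ → ℝ≥0∞) :
    ∑' i : ℤ, ENNReal.ofReal (symmCellMass n P i.natAbs) * h i.natAbs
      = ∫⁻ x, h (latticeIndex n x).natAbs ∂P := by
  have h1 := lintegral_comp_latticeIndex_eq_tsum n P fun i => h i.natAbs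
  have h2 : ∑' i : ℤ, ENNReal.ofReal (cellMass n P (-i)) * h i.natAbs
      = ∑' i : ℤ, ENNReal.ofReal (cellMass n P i) * h i.natAbs := by
    rw [← (Equiv.neg ℤ).tsum_eq]
    simp
  have h3 : ∀ i : ℤ, ENNReal.ofReal (symmCellMass n P i.natAbs) * h i.natAbs
      = ENNReal.ofReal (1 / 2) * (ENNReal.ofReal (cellMass n P i) * h i.natAbs
        + ENNReal.ofReal (cellMass n P (-i)) * h i.natAbs) := by
    intro i
    rw [symmCellMass_natAbs, ← add_mul, ← mul_assoc,
      ← ENNReal.ofReal_add (cellMass_nonneg n P _) (cellMass_nonneg n P _),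
      ← ENNReal.ofReal_mul (by norm_num)]
    congr 2
    ring
  simp only [h3]
  rw [ENNReal.tsum_mul_left, ENNReal.tsum_add, h2, h1, ← two_mul, ← mul_assoc,
    show (2 : ℝ≥0∞) = ENNReal.ofReal 2 by simp, ← ENNReal.ofReal_mul (by norm_num)]
  norm_num

/-- The log ratio `t` of the symmetrised masses is their optimal test function. It is used at shift
`j`, and reflected at shift `-j`; the average of the two bounds is the claim. -/
theorem ShiftBound.sum_klTerm_le {P : Measure ℝ} [IsProbabilityMeasure P] {V : ℝ}
    (h : ShiftBound P V) {n : ℕ} (hn : 0 < n) (hpos : ∀ k, 0 < symmCellMass n P k) {j : ℤ}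
    (hj : |j| ≤ n) (F : Finset ℤ) :
    ∑ i ∈ F, klTerm (symmCellMass n P i.natAbs) (symmCellMass n P (i - j).natAbs) ≤ V := by
  set t : ℤ → ℝ := fun i =>
    Real.log (symmCellMass n P i.natAbs / symmCellMass n P (i - j).natAbs) with ht
  have h1 := h.sum_cellMass_le hn hj F t
  have h2 := h.sum_cellMass_le hn (j := -j) (by rwa [abs_neg])
    (F.map (Equiv.neg ℤ).toEmbedding) fun i => t (-i)
  simp only [Finset.sum_map, Equiv.coe_toEmbedding, Equiv.neg_apply, neg_neg] at h2
  have h3 : ∀ i, klTerm (symmCellMass n P i.natAbs) (symmCellMass n P (i - j).natAbs)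
      = (cellMass n P i * t i - cellMass n P (i - j) * (Real.exp (t i) - 1)
        + (cellMass n P (-i) * t i - cellMass n P (-i - -j) * (Real.exp (t i) - 1))) / 2 := by
    intro i
    have h5 := hpos (i - j).natAbs
    have h6 := hpos i.natAbs
    have h4 : Real.exp (t i) = symmCellMass n P i.natAbs / symmCellMass n P (i - j).natAbs :=
      Real.exp_log (div_pos h6 h5)
    have h7 : symmCellMass n P (i - j).natAbs * Real.exp (t i) = symmCellMass n P i.natAbs := by
      rw [h4, mul_div_cancel₀ _ h5.ne']
    rw [klTerm_eq h5]
    change symmCellMass n P i.natAbs * t i + _ - _ = _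
    rw [symmCellMass_natAbs n P (i - j)] at h7 ⊢
    have h8 : -(i - j) = -i - -j := by ring
    rw [h8] at h7 ⊢
    rw [symmCellMass_natAbs n P i] at h7 ⊢
    linear_combination h7
  rw [Finset.sum_congr rfl fun i _ => h3 i, ← Finset.sum_div, Finset.sum_add_distrib,
    Finset.sum_sub_distrib, Finset.sum_sub_distrib]
  linarith

/-! ### Replacing the tail by a geometric sequence. -/

/-- The sequence `u`, with its tail from `N` on replaced by a geometric sequence of the same
mass. -/
noncomputable def geomTail (u : ℕ → ℝ) (N k : ℕ) : ℝ :=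
  if k < N then u k else (∑' l, u (l + N)) / 2 * (1 / 2) ^ (k - N)

section GeomTail

variable {u : ℕ → ℝ}

theorem le_tsum_tail (hu : ∀ k, 0 < u k) (hs : Summable u) (N : ℕ) : u N ≤ ∑' l, u (l + N) := by
  have := ((summable_nat_add_iff N).2 hs).le_tsum 0 fun k _ => (hu _).le
  simpa using this

theorem geomTail_pos (hu : ∀ k, 0 < u k) (hs : Summable u) (N k : ℕ) : 0 < geomTail u N k := by
  unfold geomTail
  split_ifs
  · exact hu k
  · have := (hu N).trans_le (le_tsum_tail hu hs N)
    positivity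

theorem hasSum_geomTail_add (hs : Summable u) {m N : ℕ} (hm : m ≤ N) :
    HasSum (fun k => geomTail u N (k + m)) (∑' k, u (k + m)) := by
  have h1 : HasSum (fun k => geomTail u N (k + N)) (∑' l, u (l + N)) := by
    have h2 : (fun k => geomTail u N (k + N)) = fun k => (∑' l, u (l + N)) / 2 * (1 / 2) ^ k := by
      ext k
      simp [geomTail]
    rw [h2]
    have h3 := hasSum_geometric_two.mul_left ((∑' l, u (l + N)) / 2)
    rw [div_mul_cancel₀ _ (two_ne_zero' ℝ)] at h3
    exact h3
  have h3 := (hasSum_nat_add_iff N).1 h1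
  have h4 : ∑ k ∈ Finset.range N, geomTail u N k = ∑ k ∈ Finset.range N, u k :=
    Finset.sum_congr rfl fun k hk => by simp [geomTail, Finset.mem_range.1 hk]
  rw [h4, add_comm, hs.sum_add_tsum_nat_add] at h3
  have h5 := (hasSum_nat_add_iff' m).2 h3
  have h6 : ∑ k ∈ Finset.range m, geomTail u N k = ∑ k ∈ Finset.range m, u k :=
    Finset.sum_congr rfl fun k hk => by
      simp [geomTail, (Finset.mem_range.1 hk).trans_le hm]
  rw [h6, ← hs.sum_add_tsum_nat_add m, add_sub_cancel_left] at h5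
  exact h5

theorem hasSum_geomTail (hs : Summable u) (N : ℕ) : HasSum (geomTail u N) (∑' k, u k) := by
  simpa using hasSum_geomTail_add hs (Nat.zero_le N)

theorem geomTail_zero {N : ℕ} (hN : 0 < N) : geomTail u N 0 = u 0 := by
  simp [geomTail, hN]

/-- Up to index `N + n` the geometric part has lost at most `n` factors `1/2`, besides the one that
normalises its mass. -/
theorem le_geomTail (hu : ∀ k, 0 < u k) (hs : Summable u) {η : ℝ} (hη : 0 < η) {s : ℕ}
    (hlow : ∀ k : ℕ, η / (2 + k) ^ s ≤ u k) {n N k : ℕ} (hk : k ≤ N + n) :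
    η / (2 ^ (n + 1) * (2 + N) ^ s) ≤ geomTail u N k := by
  have hN : η / (2 ^ (n + 1) * (2 + N) ^ s) = η / (2 + (N : ℝ)) ^ s * (1 / 2) ^ (n + 1) := by
    rw [div_pow, one_pow]
    field_simp
  rw [hN]
  unfold geomTail
  split_ifs with h
  · refine le_trans ?_ (hlow k)
    have h1 : η / (2 + (N : ℝ)) ^ s ≤ η / (2 + (k : ℝ)) ^ s := by
      gcongr
    refine (mul_le_of_le_one_right (by positivity) ?_).trans h1
    exact pow_le_one₀ (by norm_num) (by norm_num)
  · have h1 := (hlow N).trans (le_tsum_tail hu hs N)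
    have h2 : (1 / 2 : ℝ) ^ n ≤ (1 / 2) ^ (k - N) :=
      pow_le_pow_of_le_one (by norm_num) (by norm_num) (by omega)
    calc η / (2 + (N : ℝ)) ^ s * (1 / 2) ^ (n + 1)
        = η / (2 + (N : ℝ)) ^ s / 2 * (1 / 2) ^ n := by ring
      _ ≤ _ := by
        have h3 : 0 ≤ ∑' l, u (l + N) := (hu N).le.trans (le_tsum_tail hu hs N)
        gcongr

theorem geomTail_le_mul (hu : ∀ k, 0 < u k) (hs : Summable u) {n N k l : ℕ} (hk : N ≤ k)
    (hl : N ≤ l) (hlk : l ≤ k + n) : geomTail u N k ≤ 2 ^ n * geomTail u N l := by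
  have h0 := (hu N).trans_le (le_tsum_tail hu hs N)
  rw [geomTail, geomTail, if_neg (by omega), if_neg (by omega), mul_left_comm]
  refine mul_le_mul_of_nonneg_left ?_ (by positivity)
  have h1 : (1 / 2 : ℝ) ^ (k - N + n) ≤ (1 / 2) ^ (l - N) :=
    pow_le_pow_of_le_one (by norm_num) (by norm_num) (by omega)
  calc (1 / 2 : ℝ) ^ (k - N) = 2 ^ n * (1 / 2) ^ (k - N + n) := by
        rw [pow_add, mul_left_comm, ← mul_pow]
        norm_num
    _ ≤ _ := by gcongr

theorem geomTail_le_one (hu : ∀ k, 0 < u k) (hs : Summable u) (hone : 2 * ∑' k, u k - u 0 = 1)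
    (N k : ℕ) (hN : 0 < N) : geomTail u N k ≤ 1 := by
  have h1 := hasSum_int_of_even (hasSum_geomTail hs N)
  rw [geomTail_zero hN, hone] at h1
  have := le_hasSum h1 (k : ℤ) fun i _ => (geomTail_pos hu hs N _).le
  simpa using this

end GeomTail

theorem tsum_int_tail_le (f : ℕ → ℝ≥0∞) (m : ℕ) :
    ∑' i : ℤ, (if m ≤ i.natAbs then f i.natAbs else 0) ≤ 2 * ∑' k, f (k + m) := by
  set h : ℕ → ℝ≥0∞ := fun k => if m ≤ k then f k else 0 with hh
  have h1 : ∑' k, h k = ∑' k, f (k + m) := by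
    rw [← (ENNReal.summable (f := fun k => h (k + m))).sum_add_tsum_nat_add' (f := h),
      Finset.sum_eq_zero, zero_add]
    · refine tsum_congr fun k => ?_
      simp [hh]
    · intro k hk
      have := Finset.mem_range.1 hk
      simp only [hh]
      rw [if_neg (by omega)]
  have h2 : ∑' i : ℤ, h i.natAbs = ∑' k : ℕ, h k + ∑' k : ℕ, h (k + 1) := by
    rw [tsum_of_nat_of_neg_add_one ENNReal.summable ENNReal.summable]
    congr 1
  have h3 : ∑' k : ℕ, h (k + 1) ≤ ∑' k, h k :=
    ENNReal.tsum_comp_le_tsum_of_injective (add_left_injective 1) h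
  calc ∑' i : ℤ, h i.natAbs ≤ ∑' k, h k + ∑' k, h k := by
        rw [h2]
        gcongr
    _ = 2 * ∑' k, f (k + m) := by rw [h1, two_mul]

section GeomTail

variable {u : ℕ → ℝ}

theorem tsum_ofReal_geomTail_add (hu : ∀ k, 0 < u k) (hs : Summable u) {m N : ℕ} (hm : m ≤ N) :
    ∑' k, ENNReal.ofReal (geomTail u N (k + m)) = ∑' k, ENNReal.ofReal (u (k + m)) := by
  have h1 := hasSum_geomTail_add hs hm
  rw [← ENNReal.ofReal_tsum_of_nonneg (fun k => (geomTail_pos hu hs N _).le) h1.summable,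
    h1.tsum_eq, ENNReal.ofReal_tsum_of_nonneg (fun k => (hu _).le) ((summable_nat_add_iff m).2 hs)]

/-- With `N = m + 2 n`, a term with `|i| < m + n` involves only indices below `N` and is unchanged.
The other terms have both indices at least `m` and log ratio at most `log B`, so they contribute at
most `log B + 1` times the mass beyond `m`, which the new tail preserves. -/
theorem tsum_klTerm_geomTail_le (hu : ∀ k, 0 < u k) (hs : Summable u)
    (hone : 2 * ∑' k, u k - u 0 = 1) {n : ℕ} {V : ℝ} {j : ℤ} (hj : |j| ≤ n)
    (hV : ∀ F : Finset ℤ, ∑ i ∈ F, klTerm (u i.natAbs) (u (i - j).natAbs) ≤ V)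
    {η : ℝ} (hη : 0 < η) (hη1 : η ≤ 1) {s : ℕ} (hlow : ∀ k : ℕ, η / (2 + k) ^ s ≤ u k)
    {m N : ℕ} (hN0 : 0 < N) (hN : N = m + 2 * n) :
    ∑' i : ℤ, ENNReal.ofReal (klTerm (geomTail u N i.natAbs) (geomTail u N (i - j).natAbs))
      ≤ ENNReal.ofReal V
        + (ENNReal.ofReal (Real.log (2 ^ (n + 1) * (2 + N) ^ s / η)) + 1)
          * (2 * ∑' k, ENNReal.ofReal (u (k + m))) := by
  set B : ℝ := 2 ^ (n + 1) * (2 + N) ^ s / η with hB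
  have hB2 : (2 : ℝ) ^ n ≤ B := by
    rw [hB, le_div_iff₀ hη]
    have h1 : (1 : ℝ) ≤ (2 + N) ^ s := one_le_pow₀ (by linarith [(Nat.cast_nonneg N : (0 : ℝ) ≤ N)])
    have h2 : (2 : ℝ) ^ n ≤ 2 ^ (n + 1) := pow_le_pow_right₀ (by norm_num) (by omega)
    calc (2 : ℝ) ^ n * η ≤ 2 ^ n * 1 := by gcongr
      _ ≤ 2 ^ (n + 1) * (2 + N) ^ s := by gcongr
  have hB1 : 1 ≤ B := (one_le_pow₀ (by norm_num)).trans hB2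
  have hpos := geomTail_pos hu hs N
  obtain ⟨hj1, hj2⟩ := abs_le.1 hj
  have hM : 0 ≤ Real.log B := Real.log_nonneg hB1
  have hterm : ∀ k l : ℕ, geomTail u N k ≤ B * geomTail u N l →
      ENNReal.ofReal (klTerm (geomTail u N k) (geomTail u N l))
        ≤ ENNReal.ofReal (Real.log B) * ENNReal.ofReal (geomTail u N k)
          + ENNReal.ofReal (geomTail u N l) := by
    intro k l h
    rw [← ENNReal.ofReal_mul hM, ← ENNReal.ofReal_add (mul_nonneg hM (hpos k).le) (hpos l).le,
      klTerm_eq (hpos l)]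
    refine ENNReal.ofReal_le_ofReal ?_
    have h1 : Real.log (geomTail u N k / geomTail u N l) ≤ Real.log B :=
      Real.log_le_log (div_pos (hpos k) (hpos l)) ((div_le_iff₀ (hpos l)).2 h)
    have h2 := mul_le_mul_of_nonneg_left h1 (hpos k).le
    linarith [hpos k]
  have hbad : ∀ i : ℤ, m + n ≤ i.natAbs →
      geomTail u N i.natAbs ≤ B * geomTail u N (i - j).natAbs := by
    intro i hi
    -- If both indices lie in the geometric part, the ratio is at most `2 ^ n`. Otherwise `|i - j| ≤
    -- N + n`, and the lower bound on the masses applies.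
    by_cases h1 : N ≤ i.natAbs ∧ N ≤ (i - j).natAbs
    · refine (geomTail_le_mul hu hs (n := n) h1.1 h1.2 (by omega)).trans ?_
      exact mul_le_mul_of_nonneg_right hB2 (hpos _).le
    · refine (geomTail_le_one hu hs hone N _ hN0).trans ?_
      have h2 := le_geomTail hu hs hη hlow (n := n) (N := N) (k := (i - j).natAbs) (by omega)
      calc (1 : ℝ) = B * (η / (2 ^ (n + 1) * (2 + N) ^ s)) := by
            rw [hB]
            field_simp
        _ ≤ _ := by gcongr
  have hpt : ∀ i : ℤ,
      ENNReal.ofReal (klTerm (geomTail u N i.natAbs) (geomTail u N (i - j).natAbs))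
      ≤ ENNReal.ofReal (klTerm (u i.natAbs) (u (i - j).natAbs))
        + (ENNReal.ofReal (Real.log B)
            * (if m ≤ i.natAbs then ENNReal.ofReal (geomTail u N i.natAbs) else 0)
          + if m ≤ (i - j).natAbs then ENNReal.ofReal (geomTail u N (i - j).natAbs) else 0) := by
    intro i
    by_cases hi : m + n ≤ i.natAbs
    · rw [if_pos (by omega), if_pos (by omega)]
      exact (hterm _ _ (hbad i hi)).trans le_add_self
    · have h1 : geomTail u N i.natAbs = u i.natAbs := if_pos (by omega)
      have h2 : geomTail u N (i - j).natAbs = u (i - j).natAbs := if_pos (by omega)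
      rw [h1, h2]
      exact le_self_add
  have hτ : ∑' i : ℤ, (if m ≤ i.natAbs then ENNReal.ofReal (geomTail u N i.natAbs) else 0)
      ≤ 2 * ∑' k, ENNReal.ofReal (u (k + m)) := by
    refine (tsum_int_tail_le (fun k => ENNReal.ofReal (geomTail u N k)) m).trans ?_
    rw [tsum_ofReal_geomTail_add hu hs (by omega)]
  have hτ' : ∑' i : ℤ,
      (if m ≤ (i - j).natAbs then ENNReal.ofReal (geomTail u N (i - j).natAbs) else 0)
      ≤ 2 * ∑' k, ENNReal.ofReal (u (k + m)) := by
    refine le_trans (le_of_eq ?_) hτ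
    exact (Equiv.subRight j).tsum_eq fun i : ℤ =>
      if m ≤ i.natAbs then ENNReal.ofReal (geomTail u N i.natAbs) else 0
  refine (ENNReal.tsum_le_tsum hpt).trans ?_
  rw [ENNReal.tsum_add, ENNReal.tsum_add, ENNReal.tsum_mul_left, add_mul, one_mul]
  gcongr
  rw [ENNReal.tsum_eq_iSup_sum]
  refine iSup_le fun F => ?_
  rw [← ENNReal.ofReal_sum_of_nonneg fun i _ => klTerm_nonneg (hu _).le (hu _).le]
  exact ENNReal.ofReal_le_ofReal (hV F)

/-- The cost at index `N + k` is at most that at `N` times a polynomial in `k`, summable against `2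
^ (-k)`. By monotonicity, the tail mass times the cost at `N` is at most the old tail cost. -/
theorem tsum_geomTail_mul_cost_le (hu : ∀ k, 0 < u k) (hs : Summable u) {c : ℝ → ℝ}
    (hc : IsCostFunction c) {K : ℝ} {d : ℕ} (hK : 0 ≤ K)
    (hgrowth : ∀ x y, c (x + y) ≤ K * (1 + c x) * (1 + |y|) ^ d) {n : ℕ} (hn : 0 < n) (N : ℕ) :
    ∑' i : ℤ, ENNReal.ofReal (geomTail u N i.natAbs)
        * ENNReal.ofReal (c (((i.natAbs : ℝ) + 1) / n))
      ≤ ∑' i : ℤ, ENNReal.ofReal (u i.natAbs) * ENNReal.ofReal (c (((i.natAbs : ℝ) + 1) / n))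
        + 2 * (ENNReal.ofReal K * ∑' k : ℕ, ENNReal.ofReal ((1 / 2) ^ k * (1 + (k : ℝ)) ^ d))
          * ∑' k, ENNReal.ofReal (u (k + N) * (1 + c ((((k + N : ℕ) : ℝ) + 1) / n))) := by
  have hn1 : (1 : ℝ) ≤ n := by exact_mod_cast hn
  have hn' : (0 : ℝ) < n := by linarith
  set w : ℕ → ℝ := fun k => c (((k : ℝ) + 1) / n) with hw
  have hw0 : ∀ k, 0 ≤ w k := fun k => hc.nonneg _
  have hwm : ∀ k, w N ≤ w (k + N) := fun k => by
    refine hc.mono _ _ ?_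
    rw [abs_of_nonneg (by positivity), abs_of_nonneg (by positivity)]
    gcongr
    omega
  set t : ℝ := ∑' l, u (l + N) with ht
  have ht0 : 0 ≤ t := tsum_nonneg fun l => (hu _).le
  have h1 : ∀ k : ℕ, ENNReal.ofReal (geomTail u N (k + N)) * ENNReal.ofReal (w (k + N))
      ≤ (ENNReal.ofReal K * ENNReal.ofReal (t * (1 + w N)))
        * ENNReal.ofReal ((1 / 2) ^ k * (1 + (k : ℝ)) ^ d) := by
    intro k
    rw [← ENNReal.ofReal_mul (geomTail_pos hu hs N _).le, ← ENNReal.ofReal_mul hK,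
      ← ENNReal.ofReal_mul (mul_nonneg hK (mul_nonneg ht0 (by linarith [hw0 N])))]
    refine ENNReal.ofReal_le_ofReal ?_
    have h2 : geomTail u N (k + N) = t / 2 * (1 / 2) ^ k := by simp [geomTail, ht]
    have h3 : w (k + N) ≤ K * (1 + w N) * (1 + (k : ℝ)) ^ d := by
      have h4 := hgrowth (((N : ℝ) + 1) / n) (k / n)
      have h5 : ((N : ℝ) + 1) / n + k / n = (((k + N : ℕ) : ℝ) + 1) / n := by
        push_cast
        ring
      rw [h5] at h4
      refine h4.trans ?_
      have h6 : |(k : ℝ) / n| ≤ k := by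
        rw [abs_of_nonneg (by positivity)]
        exact div_le_self (Nat.cast_nonneg k) hn1
      have := hw0 N
      gcongr
    have h7 := hw0 N
    rw [h2]
    calc t / 2 * (1 / 2) ^ k * w (k + N)
        ≤ t / 2 * (1 / 2) ^ k * (K * (1 + w N) * (1 + (k : ℝ)) ^ d) := by gcongr
      _ = (K * (t * (1 + w N)) * ((1 / 2) ^ k * (1 + (k : ℝ)) ^ d)) / 2 := by ring
      _ ≤ _ := half_le_self (by positivity)
  have h8 : ENNReal.ofReal (t * (1 + w N))
      ≤ ∑' k, ENNReal.ofReal (u (k + N) * (1 + w (k + N))) := by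
    rw [ENNReal.ofReal_mul ht0, ht, ENNReal.ofReal_tsum_of_nonneg (fun k => (hu _).le)
      ((summable_nat_add_iff N).2 hs), ← ENNReal.tsum_mul_right]
    refine ENNReal.tsum_le_tsum fun k => ?_
    rw [← ENNReal.ofReal_mul (hu _).le]
    refine ENNReal.ofReal_le_ofReal ?_
    have := hwm k
    have := hu (k + N)
    gcongr
  have hpt : ∀ i : ℤ, ENNReal.ofReal (geomTail u N i.natAbs) * ENNReal.ofReal (w i.natAbs)
      ≤ ENNReal.ofReal (u i.natAbs) * ENNReal.ofReal (w i.natAbs)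
        + if N ≤ i.natAbs then
            ENNReal.ofReal (geomTail u N i.natAbs) * ENNReal.ofReal (w i.natAbs) else 0 := by
    intro i
    by_cases hi : N ≤ i.natAbs
    · rw [if_pos hi]
      exact le_add_self
    · have h9 : geomTail u N i.natAbs = u i.natAbs := if_pos (by omega)
      rw [h9]
      exact le_self_add
  refine (ENNReal.tsum_le_tsum hpt).trans ?_
  rw [ENNReal.tsum_add]
  gcongr
  refine (tsum_int_tail_le
    (fun k => ENNReal.ofReal (geomTail u N k) * ENNReal.ofReal (w k)) N).trans ?_
  refine (mul_le_mul_right (ENNReal.tsum_le_tsum h1) 2).trans ?_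
  rw [ENNReal.tsum_mul_left]
  calc _ ≤ 2 * (ENNReal.ofReal K * (∑' k, ENNReal.ofReal (u (k + N) * (1 + w (k + N))))
          * ∑' k : ℕ, ENNReal.ofReal ((1 / 2) ^ k * (1 + (k : ℝ)) ^ d)) := by gcongr
    _ = _ := by ring

/-- Since `D` does not depend on `m`, the error `(log B + 1)` times the mass beyond `m` is
controlled by a tail of the convergent cost sum. -/
theorem log_quasi_bound {c : ℝ → ℝ} (hc : IsCostFunction c) {K : ℝ} (hK : 1 ≤ K)
    (hlog : ∀ x, Real.log (2 + |x|) ≤ K * (1 + c x)) {n : ℕ} (hn : 0 < n) {η : ℝ} (hη : 0 < η)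
    (hη1 : η ≤ 1) (s : ℕ) : ∃ D : ℝ, 0 ≤ D ∧ ∀ m k : ℕ,
      Real.log (2 ^ (n + 1) * (2 + ((m + 2 * n : ℕ) : ℝ)) ^ s / η) + 1
        ≤ D * (1 + c ((((k + m : ℕ) : ℝ) + 1) / n)) := by
  have hn' : (0 : ℝ) < n := by exact_mod_cast hn
  have hn1 : (1 : ℝ) ≤ n := by exact_mod_cast hn
  have hA : 0 ≤ (n + 1 : ℝ) * Real.log 2 := by positivity
  have hE : 0 ≤ -Real.log η := neg_nonneg.2 (Real.log_nonpos hη.le hη1)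
  have hG : 0 ≤ Real.log (1 + n) := Real.log_nonneg (by linarith)
  have hH : 0 ≤ Real.log n := Real.log_nonneg hn1
  refine ⟨(n + 1) * Real.log 2 + -Real.log η + s * (Real.log (1 + n) + Real.log n + K) + 1,
    by positivity, fun m k => ?_⟩
  set x : ℝ := (((k + m : ℕ) : ℝ) + 1) / n with hx
  have hx0 : 0 ≤ x := by positivity
  have h0 := hc.nonneg x
  have h1 : Real.log (2 + ((m + 2 * n : ℕ) : ℝ)) ≤ Real.log (1 + n) + Real.log n + K * (1 + c x) := by
    have h2 : (2 + ((m + 2 * n : ℕ) : ℝ)) ≤ (1 + n) * (n * (2 + |x|)) := by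
      have h3 : (n : ℝ) * (2 + |x|) = 2 * n + (k + m) + 1 := by
        rw [abs_of_nonneg hx0, hx]
        push_cast
        field_simp
        ring
      rw [h3]
      push_cast
      have hk : (0 : ℝ) ≤ k := Nat.cast_nonneg k
      have hm : (0 : ℝ) ≤ m := Nat.cast_nonneg m
      nlinarith [mul_nonneg hn'.le hk, mul_nonneg hn'.le hm]
    have h4 := Real.log_le_log (by positivity) h2
    rw [Real.log_mul (by positivity) (by positivity), Real.log_mul (by positivity)
      (by positivity)] at h4
    linarith [hlog x]
  rw [Real.log_div (by positivity) hη.ne', Real.log_mul (by positivity) (by positivity),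
    Real.log_pow, Real.log_pow]
  push_cast at h1 ⊢
  have h5 : (0 : ℝ) ≤ s := Nat.cast_nonneg s
  have h6 := mul_le_mul_of_nonneg_left h1 h5
  have h7 : 0 ≤ ((n + 1) * Real.log 2 + -Real.log η + s * (Real.log (1 + n) + Real.log n) + 1)
      * c x := by positivity
  nlinarith

theorem exists_cactus_of_lattice {c : ℝ → ℝ} (hc : IsCostFunction c) (hu : ∀ k, 0 < u k)
    (hs : HasSum (fun i : ℤ => u i.natAbs) 1) {n : ℕ} (hn : 0 < n) {V : ℝ} (hV0 : 0 ≤ V)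
    (hV : ∀ j : ℤ, |j| ≤ n → ∀ F : Finset ℤ,
      ∑ i ∈ F, klTerm (u i.natAbs) (u (i - j).natAbs) ≤ V)
    {η : ℝ} (hη : 0 < η) {s : ℕ} (hlow : ∀ k : ℕ, η / (2 + k) ^ s ≤ u k) {A : ℝ} (hA : 0 ≤ A)
    (hcost : ∑' i : ℤ, ENNReal.ofReal (u i.natAbs)
      * ENNReal.ofReal (c (((i.natAbs : ℝ) + 1) / n)) ≤ ENNReal.ofReal A)
    {ε δ : ℝ} (hε : 0 < ε) (hδ : 0 < δ) :
    ∃ N, 0 < N ∧ ∃ Q ∈ cactusClass n N (1 / 2), expectedCost c Q ≤ ENNReal.ofReal (A + ε) ∧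
      ∀ a : ℝ, |a| ≤ 1 → klDiv Q (shiftMeasure a Q) ≤ ENNReal.ofReal (V + δ) := by
  obtain ⟨K, d, hK, hgrowth, hlog⟩ := hc.exists_growth
  wlog hη1 : η ≤ 1 generalizing η
  · refine this (η := 1) one_pos (fun k => ?_) le_rfl
    refine le_trans ?_ (hlow k)
    gcongr
    linarith
  have hinj : Function.Injective (fun k : ℕ => (k : ℤ)) := Nat.cast_injective
  have hsu : Summable u := by simpa [Function.comp_def] using hs.summable.comp_injective hinj
  have hone : 2 * ∑' k, u k - u 0 = 1 := (hasSum_int_of_even hsu.hasSum).unique hs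
  set w : ℕ → ℝ := fun k => c (((k : ℝ) + 1) / n) with hw
  have hw0 : ∀ k, 0 ≤ w k := fun k => hc.nonneg _
  -- The joint tail of mass and cost; it tends to zero and controls both the divergence error and
  -- the cost error.
  set T : ℕ → ℝ≥0∞ := fun m => ∑' k, ENNReal.ofReal (u (k + m) * (1 + w (k + m))) with hT
  have hTlim : Tendsto T atTop (𝓝 0) := by
    refine ENNReal.tendsto_sum_nat_add (fun k => ENNReal.ofReal (u k * (1 + w k))) ?_
    have h1 : ∀ k, ENNReal.ofReal (u k * (1 + w k))
        = ENNReal.ofReal (u k) + ENNReal.ofReal (u k) * ENNReal.ofReal (w k) := fun k => by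
      rw [← ENNReal.ofReal_mul (hu k).le,
        ← ENNReal.ofReal_add (hu k).le (mul_nonneg (hu k).le (hw0 k))]
      congr 1
      ring
    simp only [h1]
    rw [ENNReal.tsum_add]
    refine (ENNReal.add_lt_top.2 ⟨?_, ?_⟩).ne
    · rw [← ENNReal.ofReal_tsum_of_nonneg (fun k => (hu k).le) hsu]
      exact ENNReal.ofReal_lt_top
    · refine lt_of_le_of_lt ?_ (hcost.trans_lt ENNReal.ofReal_lt_top)
      have := ENNReal.tsum_comp_le_tsum_of_injective hinj fun i : ℤ =>
        ENNReal.ofReal (u i.natAbs) * ENNReal.ofReal (w i.natAbs)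
      simpa [hw] using this
  obtain ⟨D, hD, hDle⟩ := log_quasi_bound hc hK hlog hn hη hη1 s
  set G : ℝ≥0∞ := ENNReal.ofReal K * ∑' k : ℕ, ENNReal.ofReal ((1 / 2) ^ k * (1 + (k : ℝ)) ^ d)
    with hG
  have hGtop : G ≠ ∞ := by
    refine ENNReal.mul_ne_top ENNReal.ofReal_ne_top ?_
    have h1 : Summable fun k : ℕ => (1 / 2 : ℝ) ^ k * (1 + (k : ℝ)) ^ d := by
      have h2 := summable_pow_mul_geometric_of_norm_lt_one d (r := (1 / 2 : ℝ)) (by norm_num)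
      have h3 := ((summable_nat_add_iff 1).2 h2).mul_left 2
      refine h3.congr fun k => ?_
      push_cast
      ring
    rw [← ENNReal.ofReal_tsum_of_nonneg (fun k => by positivity) h1]
    exact ENNReal.ofReal_ne_top
  have hlim1 : Tendsto (fun m => 2 * ENNReal.ofReal D * T m) atTop (𝓝 0) := by
    have := ENNReal.Tendsto.const_mul hTlim (a := 2 * ENNReal.ofReal D)
      (Or.inr (ENNReal.mul_ne_top (by simp) ENNReal.ofReal_ne_top))
    rwa [mul_zero] at this
  have hlim2 : Tendsto (fun m => 2 * G * T (m + 2 * n)) atTop (𝓝 0) := by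
    have := ENNReal.Tendsto.const_mul (hTlim.comp (tendsto_add_atTop_nat (2 * n))) (a := 2 * G)
      (Or.inr (ENNReal.mul_ne_top (by simp) hGtop))
    rwa [mul_zero] at this
  obtain ⟨m, hm1, hm2⟩ := ((hlim1.eventually (gt_mem_nhds (ENNReal.ofReal_pos.2 hδ))).and
    (hlim2.eventually (gt_mem_nhds (ENNReal.ofReal_pos.2 hε)))).exists
  set N : ℕ := m + 2 * n with hN
  have hN0 : 0 < N := by omega
  have hpos := geomTail_pos hu hsu N
  have hsum : HasSum (fun i : ℤ => geomTail u N i.natAbs) 1 := by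
    have := hasSum_int_of_even (hasSum_geomTail hsu N)
    rwa [geomTail_zero hN0, hone] at this
  set p : Fin (N + 1) → ℝ := fun i => geomTail u N i with hp
  have hcoeff : cactusCoeff N (1 / 2) p = geomTail u N := by
    ext k
    unfold cactusCoeff
    split_ifs with hk
    · rfl
    · simp [hp, geomTail, hk]
  have hmass : cactusMass N (1 / 2) p = 1 := by
    have := hasSum_cactusCoeff_natAbs hN0 (r := 1 / 2) (by norm_num) (by norm_num) p
    rw [hcoeff] at this
    exact this.unique hsum
  refine ⟨N, hN0, cactusMeasure n N (1 / 2) p, ⟨p, fun i => ⟨(hpos _).le, ?_⟩, hmass, rfl⟩, ?_, ?_⟩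
  · exact geomTail_le_one hu hsu hone N _ hN0
  · rw [cactusMeasure_eq_latticeMeasure hn, hcoeff]
    refine (expectedCost_latticeMeasure_le hc hn _).trans ?_
    have h1 := tsum_geomTail_mul_cost_le hu hsu hc (by linarith) hgrowth hn N
    simp only [Nat.cast_natAbs, Int.cast_abs] at h1 hcost
    refine h1.trans ?_
    rw [ENNReal.ofReal_add hA hε.le]
    exact add_le_add hcost hm2.le
  · intro a ha
    rw [cactusMeasure_eq_latticeMeasure hn, hcoeff]
    refine klDiv_latticeMeasure_le hn (fun i => hpos _) hsum (fun j hj => ?_) ha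
    refine (tsum_klTerm_geomTail_le hu hsu hone hj (hV j hj) hη hη1 hlow hN0 hN).trans ?_
    rw [ENNReal.ofReal_add hV0 hδ.le]
    refine add_le_add le_rfl (le_trans ?_ hm1.le)
    rw [mul_left_comm, mul_assoc, ← ENNReal.tsum_mul_left]
    have hDT : ENNReal.ofReal D * T m = ∑' k, ENNReal.ofReal D
        * ENNReal.ofReal (u (k + m) * (1 + w (k + m))) := ENNReal.tsum_mul_left.symm
    rw [hDT]
    refine mul_le_mul_right (ENNReal.tsum_le_tsum fun k => ?_) 2
    have h2 : 0 ≤ Real.log (2 ^ (n + 1) * (2 + (N : ℝ)) ^ s / η) := by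
      refine Real.log_nonneg ?_
      rw [le_div_iff₀ hη, one_mul]
      have h3 : (1 : ℝ) ≤ (2 + N) ^ s :=
        one_le_pow₀ (by linarith [(Nat.cast_nonneg N : (0 : ℝ) ≤ N)])
      have h4 : (1 : ℝ) ≤ 2 ^ (n + 1) := one_le_pow₀ (by norm_num)
      nlinarith
    rw [← ENNReal.ofReal_one, ← ENNReal.ofReal_add h2 zero_le_one,
      ← ENNReal.ofReal_mul (by linarith), ← ENNReal.ofReal_mul hD]
    refine ENNReal.ofReal_le_ofReal ?_
    have h5 := mul_le_mul_of_nonneg_right (hDle m k) (hu (k + m)).le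
    calc _ ≤ _ := h5
      _ = _ := by ring

end GeomTail

/-! ### From noise laws to Cactus measures. -/

theorem volume_cell {n : ℕ} (hn : 0 < n) (i : ℤ) :
    volume (latticeIndex n ⁻¹' {i}) = ENNReal.ofReal (1 / n) := by
  classical
  have h1 := lintegral_comp_latticeIndex hn fun k => if k = i then 1 else 0
  rw [tsum_ite_eq, mul_one] at h1
  rw [← h1, ← lintegral_indicator_one (measurableSet_cell n i)]
  refine lintegral_congr fun x => ?_
  by_cases h : latticeIndex n x = i
  · rw [if_pos h, Set.indicator_of_mem (show x ∈ latticeIndex n ⁻¹' {i} from h), Pi.one_apply]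
  · rw [if_neg h, Set.indicator_of_notMem (show x ∉ latticeIndex n ⁻¹' {i} from h)]

theorem le_polyLaw_cell (d : ℕ) {n : ℕ} (hn : 0 < n) (i : ℤ) :
    ENNReal.ofReal (1 / (n * ∫ x, polyWeight d x) / (2 + (i.natAbs : ℝ)) ^ (d + 2))
      ≤ polyLaw d (latticeIndex n ⁻¹' {i}) := by
  have hn' : (0 : ℝ) < n := by exact_mod_cast hn
  have hn1 : (1 : ℝ) ≤ n := by exact_mod_cast hn
  have hZ := integral_polyWeight_pos d
  set Z := ∫ x, polyWeight d x
  have h1 : ENNReal.ofReal (1 / (n * Z) / (2 + (i.natAbs : ℝ)) ^ (d + 2))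
      = ∫⁻ x in latticeIndex n ⁻¹' {i},
        ENNReal.ofReal (((2 + (i.natAbs : ℝ)) ^ (d + 2))⁻¹ / Z) := by
    rw [setLIntegral_const, volume_cell hn, ← ENNReal.ofReal_mul (by positivity)]
    congr 1
    field_simp
  rw [h1, polyLaw, withDensity_apply _ (measurableSet_cell n i)]
  refine setLIntegral_mono' (measurableSet_cell n i) fun x hx => ENNReal.ofReal_le_ofReal ?_
  have h2 := abs_le_of_latticeIndex hn x
  rw [show latticeIndex n x = i from hx] at h2
  have h3 : |x| ≤ |(i : ℝ)| + 1 := h2.trans (div_le_self (by positivity) hn1)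
  refine div_le_div_of_nonneg_right ?_ hZ.le
  unfold polyWeight
  rw [Nat.cast_natAbs, Int.cast_abs]
  gcongr ?_⁻¹
  refine pow_le_pow_left₀ (by positivity) ?_ _
  linarith

theorem scaledPolyLaw_one (d : ℕ) : scaledPolyLaw d 1 = polyLaw d := by
  simp [scaledPolyLaw]

theorem tendsto_lintegral_cost_add {c : ℝ → ℝ} (hc : IsCostFunction c) {P : Measure ℝ}
    [IsProbabilityMeasure P] (hP : expectedCost c P ≠ ∞) :
    Tendsto (fun k : ℕ => ∫⁻ x, ENNReal.ofReal (c (|x| + 2 / ((k : ℝ) + 1))) ∂P) atTop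
      (𝓝 (expectedCost c P)) := by
  obtain ⟨K, d, hK, hgrowth, -⟩ := hc.exists_growth
  have hcm := hc.continuous.measurable
  refine tendsto_lintegral_of_dominated_convergence
    (fun x => ENNReal.ofReal (K * 3 ^ d) * (1 + ENNReal.ofReal (c x)))
    (fun k => by fun_prop) (fun k => ae_of_all _ fun x => ?_) ?_ (ae_of_all _ fun x => ?_)
  · have h0 := hc.nonneg x
    beta_reduce
    rw [← ENNReal.ofReal_one, ← ENNReal.ofReal_add zero_le_one h0,
      ← ENNReal.ofReal_mul (by positivity)]
    refine ENNReal.ofReal_le_ofReal ((hgrowth _ _).trans ?_)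
    rw [hc.map_abs, mul_right_comm]
    have h1 : |2 / ((k : ℝ) + 1)| ≤ 2 := by
      rw [abs_of_pos (by positivity)]
      exact div_le_self (by norm_num) (by linarith [(Nat.cast_nonneg k : (0 : ℝ) ≤ k)])
    gcongr
    linarith
  · rw [lintegral_const_mul _ (by fun_prop), lintegral_add_left measurable_const]
    refine ENNReal.mul_ne_top ENNReal.ofReal_ne_top (ENNReal.add_ne_top.2 ⟨by simp, hP⟩)
  · have h2 : Tendsto (fun k : ℕ => |x| + 2 / ((k : ℝ) + 1)) atTop (𝓝 (|x| + 2 * 0)) := by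
      have := (tendsto_one_div_add_atTop_nhds_zero_nat (𝕜 := ℝ)).const_mul 2
      simp only [mul_one_div] at this
      exact this.const_add _
    have h3 := (hc.continuous.tendsto _).comp h2
    rw [mul_zero, add_zero, hc.map_abs] at h3
    exact ENNReal.tendsto_ofReal h3

/-- A noise law with bounded cost and bounded shift sensitivity can be approximated by a
Cactus distribution. -/
theorem exists_cactus_of_shiftBound {c : ℝ → ℝ} (hc : IsCostFunction c) {P : Measure ℝ}
    [IsProbabilityMeasure P] {V A : ℝ} (hV : 0 ≤ V) (hA : 0 ≤ A) (hP : ShiftBound P V)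
    (hcost : expectedCost c P ≤ ENNReal.ofReal A) {ε δ : ℝ} (hε : 0 < ε) (hδ : 0 < δ) :
    ∃ n N : ℕ, 0 < n ∧ 0 < N ∧ ∃ Q ∈ cactusClass n N (1 / 2),
      expectedCost c Q ≤ ENNReal.ofReal (A + ε) ∧
      ∀ a : ℝ, |a| ≤ 1 → klDiv Q (shiftMeasure a Q) ≤ ENNReal.ofReal (V + δ) := by
  obtain ⟨K, d, hK, hgrowth, -⟩ := hc.exists_growth
  have hcm := hc.continuous.measurable
  set l : ℝ := Real.log ((1 + 1 / 1) ^ (d + 2)) with hl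
  have hl0 : 0 ≤ l := Real.log_nonneg (one_le_pow₀ (by norm_num))
  have hpl : ShiftBound (polyLaw d) l := by
    have := (shiftQuasiInvariant_scaledPolyLaw d one_pos).shiftBound
    rwa [scaledPolyLaw_one] at this
  have hplc := hc.expectedCost_polyLaw_lt_top hgrowth
  set A₀ : ℝ := (expectedCost c (polyLaw d)).toReal with hA₀
  have hA₀0 : 0 ≤ A₀ := ENNReal.toReal_nonneg
  have hplc' : expectedCost c (polyLaw d) ≤ ENNReal.ofReal A₀ := (ENNReal.ofReal_toReal hplc.ne).ge
  -- Mixing in `polyLaw d` bounds all cell masses below polynomially. It uses `δ / 2` and `ε / 3`;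
  -- quantisation takes another `ε / 3`, and the geometric tail takes the rest.
  obtain ⟨t, ht0, ht1, htl, htA⟩ : ∃ t : ℝ, 0 < t ∧ t ≤ 1 ∧ t * l ≤ δ / 2 ∧ t * A₀ ≤ ε / 3 := by
    refine ⟨min 1 (min (δ / 2 / (l + 1)) (ε / 3 / (A₀ + 1))), by positivity, min_le_left _ _, ?_, ?_⟩
    · have h1 : min 1 (min (δ / 2 / (l + 1)) (ε / 3 / (A₀ + 1))) ≤ δ / 2 / (l + 1) :=
        (min_le_right _ _).trans (min_le_left _ _)
      rw [le_div_iff₀ (by linarith)] at h1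
      refine le_trans ?_ h1
      gcongr
      linarith
    · have h1 : min 1 (min (δ / 2 / (l + 1)) (ε / 3 / (A₀ + 1))) ≤ ε / 3 / (A₀ + 1) :=
        (min_le_right _ _).trans (min_le_right _ _)
      rw [le_div_iff₀ (by linarith)] at h1
      refine le_trans ?_ h1
      gcongr
      linarith
  set R := mixMeasure t P (polyLaw d) with hR
  have : IsProbabilityMeasure R := mixMeasure_isProbabilityMeasure ht0.le ht1 _ _
  have hRV : ShiftBound R (V + δ / 2) :=
    (hP.mix ht0.le ht1 hpl).mono (by nlinarith)
  have hRA : expectedCost c R ≤ ENNReal.ofReal (A + ε / 3) :=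
    (expectedCost_mixMeasure_le ht0.le ht1 hA hA₀0 hcost hplc').trans
      (ENNReal.ofReal_le_ofReal (by nlinarith))
  have hlim := tendsto_lintegral_cost_add hc (hRA.trans_lt ENNReal.ofReal_lt_top).ne
  have hlt : expectedCost c R < ENNReal.ofReal (A + 2 * ε / 3) :=
    hRA.trans_lt ((ENNReal.ofReal_lt_ofReal_iff (by positivity)).2 (by linarith))
  obtain ⟨k, hk⟩ := (hlim.eventually (gt_mem_nhds hlt)).exists
  set n : ℕ := k + 1 with hn
  have hn0 : 0 < n := Nat.succ_pos k
  have hZ := integral_polyWeight_pos d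
  have hn' : (0 : ℝ) < n := by exact_mod_cast hn0
  set η : ℝ := t * (1 / (n * ∫ x, polyWeight d x)) with hη
  have hη0 : 0 < η := by positivity
  have hcell : ∀ i : ℤ, η / (2 + (i.natAbs : ℝ)) ^ (d + 2) ≤ cellMass n R i := by
    intro i
    rw [cellMass, Measure.real, ← ENNReal.ofReal_le_iff_le_toReal (measure_ne_top _ _), hη,
      mul_div_assoc, ENNReal.ofReal_mul ht0.le, hR, mixMeasure, Measure.add_apply,
      Measure.smul_apply, Measure.smul_apply, smul_eq_mul, smul_eq_mul]
    refine le_trans ?_ le_add_self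
    gcongr
    exact le_polyLaw_cell d hn0 i
  have hlow : ∀ k : ℕ, η / (2 + (k : ℝ)) ^ (d + 2) ≤ symmCellMass n R k := by
    intro k
    have h1 := hcell k
    have h2 := hcell (-k)
    simp only [Int.natAbs_neg, Int.natAbs_natCast] at h1 h2
    rw [symmCellMass]
    linarith
  have hpos : ∀ k : ℕ, 0 < symmCellMass n R k := fun k =>
    lt_of_lt_of_le (by positivity) (hlow k)
  have hcost' : ∑' i : ℤ, ENNReal.ofReal (symmCellMass n R i.natAbs)
      * ENNReal.ofReal (c (((i.natAbs : ℝ) + 1) / n)) ≤ ENNReal.ofReal (A + 2 * ε / 3) := by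
    rw [tsum_symmCellMass_mul n R fun k => ENNReal.ofReal (c (((k : ℝ) + 1) / n))]
    refine le_trans (lintegral_mono fun x => ENNReal.ofReal_le_ofReal (hc.mono _ _ ?_)) hk.le
    have h1 := abs_latticeIndex_add_one_div_le hn0 x
    have h2 : 0 ≤ (|(latticeIndex n x : ℝ)| + 1) / n := by positivity
    rw [Nat.cast_natAbs, Int.cast_abs, abs_of_nonneg h2]
    refine (h1.trans (le_of_eq ?_)).trans (le_abs_self _)
    rw [hn]
    push_cast
    rfl
  obtain ⟨N, hN, Q, hQ, hQc, hQk⟩ := exists_cactus_of_lattice hc hpos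
    (hasSum_symmCellMass_natAbs n R) hn0 (by positivity : 0 ≤ V + δ / 2)
    (fun j hj F => hRV.sum_klTerm_le hn0 hpos hj F) hη0 hlow (by positivity) hcost'
    (by positivity : 0 < ε / 3) (half_pos hδ)
  refine ⟨n, N, hn0, hN, Q, hQ, ?_, ?_⟩
  · convert hQc using 2
    ring
  · intro a ha
    convert hQk a ha using 2
    ring

/-! ### The two inequalities and the limit. -/

/-- The kernel adding noise with law `P` to its input. -/
noncomputable def additiveKernel (P : Measure ℝ) [IsProbabilityMeasure P] : Kernel ℝ ℝ :=
  ((Kernel.id : Kernel ℝ ℝ) ×ₖ Kernel.const ℝ P).map fun z => z.2 + z.1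

instance (P : Measure ℝ) [IsProbabilityMeasure P] : IsMarkovKernel (additiveKernel P) :=
  Kernel.IsMarkovKernel.map _ (by fun_prop)

theorem additiveKernel_apply (P : Measure ℝ) [IsProbabilityMeasure P] (x : ℝ) :
    additiveKernel P x = shiftMeasure x P := by
  rw [additiveKernel, Kernel.map_apply _ (by fun_prop), Kernel.prod_apply, Kernel.id_apply,
    Kernel.const_apply, Measure.dirac_prod, Measure.map_map (by fun_prop) (by fun_prop)]
  rfl

theorem optimalKL_le_of_noise {c : ℝ → ℝ} (hc : IsCostFunction c) {P : Measure ℝ}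
    [IsProbabilityMeasure P] {A : ℝ} (hP : expectedCost c P ≤ ENNReal.ofReal A) {V : ℝ≥0∞}
    (hV : ∀ a : ℝ, |a| ≤ 1 → klDiv P (shiftMeasure a P) ≤ V) : optimalKL c 1 A ≤ V := by
  have hcm := hc.continuous.measurable
  refine iInf₂_le_of_le (additiveKernel P) inferInstance (iInf_le_of_le ?_ ?_)
  · refine iSup_le fun x => le_trans (le_of_eq ?_) hP
    rw [additiveKernel_apply, expectedCost, shiftMeasure, lintegral_map (by fun_prop) (by fun_prop)]
    simp [expectedCost]
  · refine iSup_le fun x => iSup₂_le fun x' hx => ?_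
    rw [additiveKernel_apply, additiveKernel_apply]
    have h1 : shiftMeasure x' P = (shiftMeasure (x' - x) P).map fun y => y + x := by
      rw [shiftMeasure, shiftMeasure, Measure.map_map (by fun_prop) (by fun_prop)]
      congr 1 with y
      simp only [Function.comp_apply]
      ring
    have : IsProbabilityMeasure (shiftMeasure (x' - x) P) :=
      Measure.isProbabilityMeasure_map (by fun_prop)
    rw [h1]
    exact (klDiv_map_le _ _ (by fun_prop)).trans (hV _ (by rwa [abs_sub_comm]))

theorem cactusInfKL_le {c : ℝ → ℝ} {n N : ℕ} (hn : 0 < n) (hN : 0 < N) {Q : Measure ℝ}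
    (hQ : Q ∈ cactusClass n N (1 / 2)) {A : ℝ} (hA : expectedCost c Q ≤ ENNReal.ofReal A)
    {V : ℝ≥0∞} (hV : ∀ a : ℝ, |a| ≤ 1 → klDiv Q (shiftMeasure a Q) ≤ V) :
    cactusInfKL c A ≤ V :=
  iInf₂_le_of_le n hn <| iInf₂_le_of_le N hN <|
    iInf₂_le_of_le (1 / 2) ⟨by norm_num, by norm_num⟩ <| iInf₂_le_of_le Q hQ <|
      iInf_le_of_le hA <| iSup₂_le hV

theorem cactusInfKL_le_optimalKL {c : ℝ → ℝ} (hc : IsCostFunction c) {C : ℝ} (hC : 0 < C) {ε : ℝ}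
    (hε : 0 < ε) : cactusInfKL c (C + ε) ≤ optimalKL c 1 C := by
  refine le_iInf fun κ => le_iInf fun hκ => le_iInf fun hcost => ?_
  set W := ⨆ (x : ℝ) (x' : ℝ) (_ : |x - x'| ≤ 1), klDiv (κ x) (κ x') with hW
  by_cases hWtop : W = ∞
  · rw [hWtop]
    exact le_top
  have hκW : ∀ x x' : ℝ, |x - x'| ≤ 1 → klDiv (κ x) (κ x') ≤ ENNReal.ofReal W.toReal := by
    intro x x' hx
    rw [ENNReal.ofReal_toReal hWtop]
    exact le_iSup_of_le x (le_iSup₂_of_le x' hx le_rfl)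
  refine ENNReal.le_of_forall_pos_le_add fun δ hδ _ => ?_
  have hδ' : (0 : ℝ) < δ / 2 := by positivity
  -- The cost bound on the kernel holds for every input, so the input law needs no moments and the
  -- parameter `0` suffices.
  obtain ⟨μ, hμ, hμl⟩ := exists_shiftQuasiInvariant 0 hδ'
  have h1 := hμl.shiftBound_noiseLaw κ ENNReal.toReal_nonneg hκW
  have h2 := expectedCost_noiseLaw_le hc.continuous.measurable μ κ (iSup_le_iff.1 hcost)
  obtain ⟨n, N, hn, hN, Q, hQ, hQc, hQk⟩ := exists_cactus_of_shiftBound hc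
    (add_nonneg ENNReal.toReal_nonneg hδ'.le) hC.le h1 h2 hε hδ'
  refine (cactusInfKL_le hn hN hQ hQc hQk).trans (le_of_eq ?_)
  rw [add_assoc, add_halves, ENNReal.ofReal_add ENNReal.toReal_nonneg δ.coe_nonneg,
    ENNReal.ofReal_toReal hWtop, ENNReal.ofReal_coe_nnreal]

/-- Convexity gives a linear modulus of continuity in the cost level: a fraction `t` of narrow noise
lowers the cost by a multiple of `t` and adds at most `t * D` to the divergence bound. -/
theorem optimalKL_le_cactusInfKL_add {c : ℝ → ℝ} (hc : IsCostFunction c) {C : ℝ} (hC : 0 < C) :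
    ∃ D : ℝ, 0 ≤ D ∧ ∀ t : ℝ, 0 < t → t ≤ 1 →
      optimalKL c 1 C ≤ cactusInfKL c (C + t * (C / 4)) + ENNReal.ofReal (t * D) := by
  obtain ⟨K, d, hK, hgrowth, -⟩ := hc.exists_growth
  obtain ⟨L, hL, hLc⟩ := hc.exists_scaledPolyLaw_cost_le hgrowth
    (η := ENNReal.ofReal (C / 4)) (ENNReal.ofReal_pos.2 (by positivity))
  have hLb := (shiftQuasiInvariant_scaledPolyLaw d hL).shiftBound
  set D : ℝ := Real.log ((1 + 1 / L) ^ (d + 2)) with hD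
  have hD0 : 0 ≤ D := by
    refine Real.log_nonneg (one_le_pow₀ ?_)
    have : 0 < 1 / L := by positivity
    linarith
  refine ⟨D, hD0, fun t ht0 ht1 => ?_⟩
  rw [← tsub_le_iff_right]
  refine le_iInf₂ fun n hn => le_iInf₂ fun N hN => le_iInf₂ fun r hr => le_iInf₂ fun P hP =>
    le_iInf fun hPc => ?_
  have hPp := isProbabilityMeasure_of_mem_cactusClass hn hN hr hP
  set W := ⨆ (a : ℝ) (_ : |a| ≤ 1), klDiv P (shiftMeasure a P) with hW
  rw [tsub_le_iff_right]
  by_cases hWtop : W = ∞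
  · simp [hWtop]
  have hPb : ShiftBound P W.toReal := by
    refine ShiftBound.of_klDiv_le ENNReal.toReal_nonneg fun a ha => ?_
    rw [ENNReal.ofReal_toReal hWtop]
    exact le_iSup₂_of_le a ha le_rfl
  have := mixMeasure_isProbabilityMeasure ht0.le ht1 P (scaledPolyLaw d L)
  have hW0 : 0 ≤ W.toReal := ENNReal.toReal_nonneg
  have hmix : ShiftBound (mixMeasure t P (scaledPolyLaw d L)) (W.toReal + t * D) :=
    (hPb.mix ht0.le ht1 hLb).mono (by nlinarith)
  -- `(1 - t) (C + t C / 4) + t C / 4 = C - t C / 2 - t² C / 4`; a slack of `t C / 4` below `C` is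
  -- kept for the Cactus approximation of the mixture.
  have hmixc : expectedCost c (mixMeasure t P (scaledPolyLaw d L))
      ≤ ENNReal.ofReal (C - t * (C / 4)) :=
    (expectedCost_mixMeasure_le ht0.le ht1 (by positivity) (by positivity) hPc hLc).trans
      (ENNReal.ofReal_le_ofReal (by nlinarith [mul_pos ht0 hC, mul_pos (mul_pos ht0 ht0) hC]))
  refine ENNReal.le_of_forall_pos_le_add fun δ hδ _ => ?_
  obtain ⟨n', N', hn', hN', Q, hQ, hQc, hQk⟩ := exists_cactus_of_shiftBound hc
    (by positivity : 0 ≤ W.toReal + t * D) (by nlinarith : 0 ≤ C - t * (C / 4)) hmix hmixc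
    (by positivity : 0 < t * (C / 4)) (NNReal.coe_pos.2 hδ)
  rw [sub_add_cancel] at hQc
  have := isProbabilityMeasure_of_mem_cactusClass hn' hN' ⟨by norm_num, by norm_num⟩ hQ
  refine (optimalKL_le_of_noise hc hQc hQk).trans (le_of_eq ?_)
  rw [ENNReal.ofReal_add (by positivity) δ.coe_nonneg, ENNReal.ofReal_add hW0 (by positivity),
    ENNReal.ofReal_toReal hWtop, ENNReal.ofReal_coe_nnreal]

/-- The limit defining `KL*_Cactus` exists and is equal to `KL*` (with sensitivity `s = 1`). -/
theorem theorem3 (c : ℝ → ℝ) (hc : IsCostFunction c) (C : ℝ) (hC : 0 < C) :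
    Tendsto (fun ε : ℝ => cactusInfKL c (C + ε)) (𝓝[>] 0) (𝓝 (optimalKL c 1 C)) := by
  obtain ⟨D, hD, hle⟩ := optimalKL_le_cactusInfKL_add hc hC
  have hlim : Tendsto (fun ε : ℝ => optimalKL c 1 C - ENNReal.ofReal (ε / (C / 4) * D)) (𝓝[>] 0)
      (𝓝 (optimalKL c 1 C - 0)) := by
    refine ENNReal.Tendsto.sub tendsto_const_nhds ?_ (Or.inr ENNReal.zero_ne_top)
    have h1 : Tendsto (fun ε : ℝ => ε / (C / 4) * D) (𝓝 0) (𝓝 (0 / (C / 4) * D)) :=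
      ((continuous_id.div_const _).mul_const _).tendsto 0
    rw [zero_div, zero_mul] at h1
    simpa using ENNReal.tendsto_ofReal (h1.mono_left nhdsWithin_le_nhds)
  rw [tsub_zero] at hlim
  have hmem : Set.Ioc (0 : ℝ) (C / 4) ∈ 𝓝[>] (0 : ℝ) := Ioc_mem_nhdsGT (by positivity)
  refine tendsto_of_tendsto_of_tendsto_of_le_of_le' hlim tendsto_const_nhds ?_ ?_
  · filter_upwards [hmem] with ε hε
    have hC4 : 0 < C / 4 := by positivity
    -- This `t` makes the excess `t * (C / 4)` equal to `ε`.
    have h := hle (ε / (C / 4)) (div_pos hε.1 hC4) ((div_le_one hC4).2 hε.2)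
    rw [div_mul_cancel₀ _ hC4.ne'] at h
    exact tsub_le_iff_right.2 h
  · filter_upwards [hmem] with ε hε
    exact cactusInfKL_le_optimalKL hc hC hε.1
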